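/- Let $(V,pV,K)$ be a complete discrete valuation ring of unramified mixed characteristic $p>0$ (that is, $V$ is a complete DVR of characteristic $0$ whose maximal ideal is generated by the prime number $p$), let $n\ge 0$, and let $S=V[[x_1,\dots,x_n]]$, a local ring with maximal ideal $m=(p,x_1,\dots,x_n)$ and residue field $K$. Let $D(S,V)\subseteq \operatorname{End}_V(S)$ be the ring of $V$-linear differential operators of $S$: operators of order $0$ are the multiplications by elements of $S$, and $\phi\in\operatorname{End}_V(S)$ has order at most $k+1$ if $\phi\sigma-\sigma\phi$ has order at most $k$ for every $\sigma\in S$. Let $$E_S(K)=H^{n+1}_m(S)=\operatorname{coker}\Big(\bigoplus_{i=0}^n S_{y_0\cdots\widehat{y_i}\cdots y_n}\to S_{y_0\cdots y_n}\Big),\qquad (y_0,\dots,y_n)=(p,x_1,\dots,x_n),$$ with the $D(S,V)$-module structure induced by the unique extension of differential operators to localizations of $S$. Then: (i) as an $S$-module, $E_S(K)$ is an injective hull of $K$; (ii) if $N\subsetneq E_S(K)$ is a proper $D(S,V)$-submodule, then $N=\operatorname{Ann}_{E_S(K)}p^\ell S=\{e\in E_S(K): p^\ell S\cdot e=0\}$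 for some $\ell\in\mathbb N=\{0,1,2,\dots\}$; (iii) $\operatorname{End}_{D(S,V)}(E_S(K))=V$, that is, sending $a\in V$ to multiplication by $a$ is a bijective ring homomorphism $V\to\operatorname{End}_{D(S,V)}(E_S(K))$. -/

import Mathlib

/-! ### Differential operators -/

section DiffOp

variable (R S : Type*) [CommRing R] [CommRing S] [Algebra R S]

/-- `IsDiffOp R S k φ`: the `R`-linear endomorphism `φ` of `S` is a differential operator of order
at most `k`. Order zero means multiplication by an element of `S`; order at most `k + 1` means that
all commutators `φ ∘ σ - σ ∘ φ` with multiplications by `σ ∈ S` have order at most `k`. -/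
def IsDiffOp : ℕ → Module.End R S → Prop
  | 0, φ => ∃ s : S, φ = LinearMap.mulLeft R s
  | k + 1, φ => ∀ σ : S, IsDiffOp k (φ * LinearMap.mulLeft R σ - LinearMap.mulLeft R σ * φ)

end DiffOp

section Aux

variable {R S : Type*} [CommRing R] [CommRing S] [Algebra R S]
variable {M : Type*} [AddCommGroup M] [Module R M] [Module S M] [IsScalarTower R S M]

/-- The commutator of an `R`-linear endomorphism of an `S`-module with the action of `s ∈ S`. -/
def actionComm (φ : Module.End R M) (s : S) : Module.End R M :=
  φ * Algebra.lsmul R R M s - Algebra.lsmul R R M s * φ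

@[simp] theorem actionComm_apply (φ : Module.End R M) (s : S) (m : M) :
    actionComm φ s m = φ (s • m) - s • φ m := rfl

variable (S) in
/-- Differential operators on an `S`-module, with the order shifted by one: `OrderLT S k φ` says
that `φ` has order `< k`. -/
def OrderLT : ℕ → Module.End R M → Prop
  | 0, φ => φ = 0
  | k + 1, φ => ∀ s : S, OrderLT k (actionComm φ s)

theorem OrderLT.zero (k : ℕ) : OrderLT S k (0 : Module.End R M) := by
  induction k with
  | zero => rfl
  | succ k ih =>
    intro s
    have : actionComm (0 : Module.End R M) s = 0 := by ext; simp
    rwa [this]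

theorem OrderLT.succ {k : ℕ} {φ : Module.End R M} (h : OrderLT S k φ) : OrderLT S (k + 1) φ := by
  induction k generalizing φ with
  | zero =>
    obtain rfl : φ = 0 := h
    exact OrderLT.zero _
  | succ k ih => exact fun s => ih (h s)

theorem OrderLT.mono {k l : ℕ} (hkl : k ≤ l) {φ : Module.End R M} (h : OrderLT S k φ) :
    OrderLT S l φ := by
  induction hkl with
  | refl => exact h
  | step _ ih => exact ih.succ

theorem OrderLT.add {k : ℕ} {φ ψ : Module.End R M} (h : OrderLT S k φ) (h' : OrderLT S k ψ) :
    OrderLT S k (φ + ψ) := by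
  induction k generalizing φ ψ with
  | zero =>
    obtain rfl : φ = 0 := h
    obtain rfl : ψ = 0 := h'
    exact add_zero _
  | succ k ih =>
    intro s
    have : actionComm (φ + ψ) s = actionComm φ s + actionComm ψ s := by
      ext; simp; abel
    rw [this]
    exact ih (h s) (h' s)

theorem OrderLT.neg {k : ℕ} {φ : Module.End R M} (h : OrderLT S k φ) : OrderLT S k (-φ) := by
  induction k generalizing φ with
  | zero =>
    obtain rfl : φ = 0 := h
    exact neg_zero
  | succ k ih =>
    intro s
    have : actionComm (-φ) s = -actionComm φ s := by
      ext; simp; abel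
    rw [this]
    exact ih (h s)

theorem OrderLT.sub {k : ℕ} {φ ψ : Module.End R M} (h : OrderLT S k φ) (h' : OrderLT S k ψ) :
    OrderLT S k (φ - ψ) := by
  rw [sub_eq_add_neg]; exact h.add h'.neg

theorem OrderLT.mul {k l : ℕ} {φ ψ : Module.End R M} (h : OrderLT S k φ) (h' : OrderLT S l ψ) :
    OrderLT S (k + l) (φ * ψ) := by
  induction hn : k + l generalizing k l φ ψ with
  | zero =>
    obtain rfl : k = 0 := by omega
    obtain rfl : φ = 0 := h
    exact zero_mul _
  | succ n ih =>
    match k, l, h, h' with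
    | 0, _, h, _ =>
      obtain rfl : φ = 0 := h
      rw [zero_mul]; exact OrderLT.zero _
    | _, 0, _, h' =>
      obtain rfl : ψ = 0 := h'
      rw [mul_zero]; exact OrderLT.zero _
    | k + 1, l + 1, h, h' =>
      intro s
      have : actionComm (φ * ψ) s = φ * actionComm ψ s + actionComm φ s * ψ := by
        ext; simp
      rw [this]
      exact (ih h (h' s) (by omega)).add (ih (h s) h' (by omega))

theorem orderLT_one_lsmul (s : S) : OrderLT S 1 (Algebra.lsmul R R M s) := by
  intro t
  change actionComm _ t = 0
  ext m
  simp [smul_comm s t m]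

theorem actionComm_self (φ : Module.End R S) (s : S) :
    actionComm φ s = φ * LinearMap.mulLeft R s - LinearMap.mulLeft R s * φ := rfl

theorem isDiffOp_iff_orderLT (k : ℕ) (φ : Module.End R S) :
    IsDiffOp R S k φ ↔ OrderLT S (k + 1) φ := by
  induction k generalizing φ with
  | zero =>
    constructor
    · rintro ⟨s, rfl⟩
      exact orderLT_one_lsmul s
    · intro h
      refine ⟨φ 1, ?_⟩
      ext t
      have h1 := LinearMap.congr_fun (show actionComm φ t = 0 from h t) 1
      simp only [actionComm_apply, smul_eq_mul, mul_one, LinearMap.zero_apply, sub_eq_zero] at h1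
      simp [h1, mul_comm]
  | succ k ih => exact forall_congr' fun s => ih _

end Aux

section DiffOpRing

variable (R S : Type*) [CommRing R] [CommRing S] [Algebra R S]

/-- The ring `D(S, R)` of `R`-linear differential operators of `S`, as a subring (indeed
`R`-subalgebra) of `End_R(S)`. -/
def DiffOpRing : Subalgebra R (Module.End R S) where
  carrier := {φ | ∃ k, IsDiffOp R S k φ}
  mul_mem' := by
    rintro a b ⟨k, hk⟩ ⟨l, hl⟩
    rw [isDiffOp_iff_orderLT] at hk hl
    exact ⟨k + 1 + l, (isDiffOp_iff_orderLT _ _).2 (hk.mul hl)⟩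
  add_mem' := by
    rintro a b ⟨k, hk⟩ ⟨l, hl⟩
    rw [isDiffOp_iff_orderLT] at hk hl
    exact ⟨k + l, (isDiffOp_iff_orderLT _ _).2
      ((hk.mono (by omega)).add (hl.mono (by omega)))⟩
  algebraMap_mem' r := ⟨0, algebraMap R S r, by ext; simp [Algebra.smul_def]⟩

/-- Multiplication by `s ∈ S`, as an operator of order zero. -/
def DiffOpRing.mulOp (s : S) : DiffOpRing R S := ⟨LinearMap.mulLeft R s, 0, s, rfl⟩

end DiffOpRing

/-! ### The action of differential operators on localizations -/

section Localization

variable {R S : Type*} [CommRing R] [CommRing S] [Algebra R S]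
variable (W : Submonoid S)
variable {T : Type*} [CommRing T] [Algebra S T] [Algebra R T] [IsScalarTower R S T]
  [IsLocalization W T]

/-- A differential operator on a localization is determined by its values on `S`. -/
theorem OrderLT.eq_zero_of_comp (W : Submonoid S) [IsLocalization W T] {k : ℕ} {Q : Module.End R T} (h : OrderLT S k Q)
    (h0 : ∀ s : S, Q (algebraMap S T s) = 0) : Q = 0 := by
  induction k generalizing Q with
  | zero => exact h
  | succ k ih =>
    have hc : ∀ s : S, actionComm Q s = 0 := fun s => ih (h s) fun t => by
      rw [actionComm_apply, h0, smul_zero, sub_zero, Algebra.smul_def, ← map_mul, h0]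
    ext t
    obtain ⟨⟨a, g⟩, hag⟩ := IsLocalization.surj W t
    have h1 := LinearMap.congr_fun (hc g) t
    rw [actionComm_apply, Algebra.smul_def, mul_comm, hag, h0, zero_sub, LinearMap.zero_apply,
      neg_eq_zero, Algebra.smul_def] at h1
    exact (IsLocalization.map_units T g).mul_right_eq_zero.1 h1

theorem OrderLT.pow_mul_eq_zero {k : ℕ} {P : Module.End R S} (h : OrderLT S k P) {u z : S}
    (hz : u * z = 0) : u ^ k * P z = 0 := by
  induction k generalizing P with
  | zero =>
    obtain rfl : P = 0 := h
    simp
  | succ k ih =>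
    have h1 := ih (h u)
    rw [actionComm_apply, smul_eq_mul, hz, map_zero, zero_sub, smul_eq_mul] at h1
    linear_combination -h1

theorem OrderLT.exists_extension (T : Type*) [CommRing T] [Algebra S T] [Algebra R T]
    [IsScalarTower R S T] [IsLocalization W T] {k : ℕ} {P : Module.End R S} (h : OrderLT S k P) :
    ∃ Q : Module.End R T, OrderLT S k Q ∧
      ∀ s : S, Q (algebraMap S T s) = algebraMap S T (P s) := by
  induction k generalizing P with
  | zero =>
    obtain rfl : P = 0 := h
    exact ⟨0, rfl, by simp⟩
  | succ k ih =>
    choose E hE hEP using fun s => ih (h s)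
    have uniq : ∀ {A B : Module.End R T}, OrderLT S k A → OrderLT S k B →
        (∀ s, A (algebraMap S T s) = B (algebraMap S T s)) → A = B := fun hA hB hAB =>
      sub_eq_zero.1 ((hA.sub hB).eq_zero_of_comp W fun s => by simp [hAB])
    have hker : ∀ a b : S, algebraMap S T a = algebraMap S T b →
        algebraMap S T (P a) = algebraMap S T (P b) := by
      intro a b hab
      obtain ⟨c, hc⟩ := (IsLocalization.eq_iff_exists W T).1 hab
      have h1 := h.pow_mul_eq_zero (u := (c : S)) (z := a - b) (by rw [mul_sub, hc, sub_self])
      refine (IsLocalization.eq_iff_exists W T).2 ⟨c ^ (k + 1), ?_⟩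
      rw [map_sub] at h1
      push_cast
      linear_combination h1
    have hunit : ∀ g : W, ∀ t : T, ∃ q : T, algebraMap S T g * q = t := fun g t => by
      obtain ⟨u, hu⟩ := IsLocalization.map_units T g
      exact ⟨↑u⁻¹ * t, by rw [← hu, Units.mul_inv_cancel_left]⟩
    have hcancel : ∀ g : W, ∀ {x y : T}, algebraMap S T g * x = algebraMap S T g * y → x = y :=
      fun g _ _ hxy => (IsLocalization.map_units T g).mul_left_cancel hxy
    have hEmul : ∀ g h' : S, ∀ t b, algebraMap S T h' * t = algebraMap S T b →
        E (g * h') t = algebraMap S T (P (g * b) - g * P b) + algebraMap S T g * E h' t := by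
      intro g h' t b hb
      have e : E (g * h') = E g * Algebra.lsmul R R T h' + Algebra.lsmul R R T g * E h' := by
        refine sub_eq_zero.1 (OrderLT.eq_zero_of_comp W (k := k + 1) ?_ ?_)
        · refine (hE _).succ.sub (((hE g).mul (orderLT_one_lsmul h')).add ?_)
          rw [add_comm k 1]
          exact (orderLT_one_lsmul g).mul (hE h')
        · intro s
          change E (g * h') _ - (E g (h' • _) + g • E h' _) = 0
          rw [Algebra.smul_def h', ← map_mul]
          simp only [hEP, actionComm_apply, smul_eq_mul, Algebra.smul_def g (algebraMap S T _),
            ← map_mul, ← map_add, ← map_sub]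
          convert map_zero (algebraMap S T) using 2
          rw [mul_assoc g h' s]
          ring
      rw [e]
      change E g (h' • t) + g • E h' t = _
      rw [Algebra.smul_def, Algebra.smul_def, hb, hEP, actionComm_apply, smul_eq_mul, smul_eq_mul]
    have hswap : ∀ s g : S, ∀ t, E s (g • t) - g • E s t = E g (s • t) - s • E g t := by
      intro s g t
      have e : actionComm (E s) g = actionComm (E g) s := by
        refine sub_eq_zero.1 (OrderLT.eq_zero_of_comp W (k := k + 1) ?_ ?_)
        · exact OrderLT.sub (OrderLT.succ (hE s)|>.succ g) (OrderLT.succ (hE g)|>.succ s)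
        · intro x
          simp only [LinearMap.sub_apply, actionComm_apply, Algebra.smul_def _ (algebraMap S T _),
            ← map_mul, hEP, smul_eq_mul, ← map_sub]
          rw [mul_left_comm g s x]
          convert map_zero (algebraMap S T) using 2
          ring
      exact LinearMap.congr_fun e t
    have hspec : ∀ t : T, ∃ q : T, ∀ (g : W) (a : S), algebraMap S T g * t = algebraMap S T a →
        algebraMap S T g * q = algebraMap S T (P a) - E g t := by
      intro t
      obtain ⟨⟨a, g⟩, hag⟩ := IsLocalization.surj W t
      rw [mul_comm] at hag
      obtain ⟨q, hq⟩ := hunit g (algebraMap S T (P a) - E g t)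
      refine ⟨q, fun h' b hb => hcancel g ?_⟩
      have e1 := hEmul g h' t b hb
      have e2 := hEmul h' g t a hag
      rw [mul_comm (h' : S) g] at e2
      have e3 := hker (g * b) (h' * a) (by rw [map_mul, map_mul, ← hb, ← hag]; ring)
      simp only [map_sub, map_mul] at e1 e2
      linear_combination algebraMap S T h' * hq - e1 + e2 - e3
    choose q hq using hspec
    have hsm : ∀ (c : R) (a : S), algebraMap S T (c • a) = c • algebraMap S T a := fun c a => by
      rw [Algebra.smul_def, map_mul, ← IsScalarTower.algebraMap_apply, ← Algebra.smul_def]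
    have hcommon : ∀ t₁ t₂ : T, ∃ (g : W) (a b : S), algebraMap S T g * t₁ = algebraMap S T a ∧
        algebraMap S T g * t₂ = algebraMap S T b := by
      intro t₁ t₂
      obtain ⟨⟨a, g⟩, hag⟩ := IsLocalization.surj W t₁
      obtain ⟨⟨b, g'⟩, hbg⟩ := IsLocalization.surj W t₂
      refine ⟨g * g', g' * a, g * b, ?_, ?_⟩
      · simp only [Submonoid.coe_mul, map_mul] at hag ⊢
        linear_combination algebraMap S T g' * hag
      · simp only [Submonoid.coe_mul, map_mul] at hbg ⊢
        linear_combination algebraMap S T g * hbg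
    let Q : Module.End R T :=
      { toFun := q
        map_add' := by
          intro t₁ t₂
          obtain ⟨g, a, b, ha, hb⟩ := hcommon t₁ t₂
          refine hcancel g ?_
          have e := hq (t₁ + t₂) g (a + b) (by rw [mul_add, ha, hb, map_add])
          rw [e, mul_add, hq t₁ g a ha, hq t₂ g b hb, map_add, map_add, map_add]
          ring
        map_smul' := by
          intro c t
          obtain ⟨g, a, -, ha, -⟩ := hcommon t t
          refine hcancel g ?_
          have e := hq (c • t) g (c • a) (by rw [mul_smul_comm, ha, hsm])
          rw [e, RingHom.id_apply, mul_smul_comm, hq t g a ha, P.map_smul, (E g).map_smul, smul_sub,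
            hsm] }
    have hQ : ∀ t, Q t = q t := fun _ => rfl
    refine ⟨Q, fun s => ?_, fun s => ?_⟩
    · have : actionComm Q s = E s := by
        ext t
        obtain ⟨g, a, -, ha, -⟩ := hcommon t t
        refine hcancel g ?_
        have e1 := hq t g a ha
        have e2 := hq (s • t) g (s * a) (by
          rw [Algebra.smul_def, mul_left_comm, ha, map_mul])
        have e3 := hswap s g t
        rw [Algebra.smul_def (g : S) t, ha, hEP] at e3
        simp only [actionComm_apply, hQ, Algebra.smul_def, map_sub, map_mul]
          at e1 e2 e3 ⊢
        linear_combination e2 - algebraMap S T s * e1 + e3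
      rw [this]
      exact hE s
    · have e := hq (algebraMap S T s) 1 s (by simp)
      have e1 : E 1 (algebraMap S T s) = 0 := by rw [hEP]; simp
      simpa [e1, hQ] using e

theorem DiffOpRing.exists_extension (T : Type*) [CommRing T] [Algebra S T] [Algebra R T]
    [IsScalarTower R S T] [IsLocalization W T] (P : DiffOpRing R S) :
    ∃ Q : Module.End R T, (∃ k, OrderLT S k Q) ∧
      ∀ s : S, Q (algebraMap S T s) = algebraMap S T (P.1 s) := by
  obtain ⟨k, hk⟩ := P.2
  obtain ⟨Q, hQ, hQP⟩ := ((isDiffOp_iff_orderLT _ _).1 hk).exists_extension W T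
  exact ⟨Q, ⟨_, hQ⟩, hQP⟩

/-- The unique extension of a differential operator of `S` to a differential operator on the
localization `T` of `S`. -/
noncomputable def DiffOpRing.extend (T : Type*) [CommRing T] [Algebra S T] [Algebra R T]
    [IsScalarTower R S T] [IsLocalization W T] (P : DiffOpRing R S) : Module.End R T :=
  (DiffOpRing.exists_extension W T P).choose

theorem DiffOpRing.extend_orderLT (P : DiffOpRing R S) : ∃ k, OrderLT S k (DiffOpRing.extend W T P) :=
  (DiffOpRing.exists_extension W T P).choose_spec.1

@[simp] theorem DiffOpRing.extend_algebraMap (P : DiffOpRing R S) (s : S) :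
    DiffOpRing.extend W T P (algebraMap S T s) = algebraMap S T (P.1 s) :=
  (DiffOpRing.exists_extension W T P).choose_spec.2 s

theorem DiffOpRing.extend_unique (P : DiffOpRing R S) {Q : Module.End R T} {k : ℕ}
    (hQ : OrderLT S k Q) (h : ∀ s : S, Q (algebraMap S T s) = algebraMap S T (P.1 s)) :
    DiffOpRing.extend W T P = Q := by
  obtain ⟨l, hl⟩ := DiffOpRing.extend_orderLT W (T := T) P
  refine sub_eq_zero.1 (OrderLT.eq_zero_of_comp W (k := k + l)
    ((hl.mono (by omega)).sub (hQ.mono (by omega))) fun s => ?_)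
  rw [LinearMap.sub_apply, extend_algebraMap, h, sub_self]

theorem DiffOpRing.extend_mulOp (s : S) :
    DiffOpRing.extend W T (DiffOpRing.mulOp R S s) = Algebra.lsmul R R T s :=
  DiffOpRing.extend_unique W _ (orderLT_one_lsmul s) fun t => by
    simp [DiffOpRing.mulOp, Algebra.smul_def]

variable (T) in
/-- The action of `D(S, R)` on the localization `T` of `S`. -/
noncomputable def DiffOpRing.extendHom : DiffOpRing R S →ₐ[R] Module.End R T :=
  AlgHom.ofLinearMap
    { toFun := fun P => DiffOpRing.extend W T P
      map_add' := fun P P' => by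
        obtain ⟨k, hk⟩ := DiffOpRing.extend_orderLT W (T := T) P
        obtain ⟨l, hl⟩ := DiffOpRing.extend_orderLT W (T := T) P'
        exact DiffOpRing.extend_unique W _ (k := k + l)
          ((hk.mono (by omega)).add (hl.mono (by omega))) fun s => by simp
      map_smul' := fun c P => by
        obtain ⟨k, hk⟩ := DiffOpRing.extend_orderLT W (T := T) P
        refine DiffOpRing.extend_unique W _ (k := 1 + k) (Q := c • DiffOpRing.extend W T P) ?_
          fun s => ?_
        swap
        · rw [LinearMap.smul_apply, extend_algebraMap, Subalgebra.coe_smul, LinearMap.smul_apply,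
            Algebra.smul_def c (P.1 s), map_mul, ← IsScalarTower.algebraMap_apply,
            ← Algebra.smul_def]
        have : c • DiffOpRing.extend W T P = Algebra.lsmul R R T (algebraMap R S c) * DiffOpRing.extend W T P := by
          ext; simp
        rw [this]
        exact (orderLT_one_lsmul _).mul hk }
    (DiffOpRing.extend_unique W _ (k := 1)
      (by simpa using orderLT_one_lsmul (R := R) (M := T) (1 : S)) fun s => by simp)
    (fun P P' => by
      obtain ⟨k, hk⟩ := DiffOpRing.extend_orderLT W (T := T) P
      obtain ⟨l, hl⟩ := DiffOpRing.extend_orderLT W (T := T) P'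
      exact DiffOpRing.extend_unique W _ (k := k + l) (hk.mul hl) fun s => by simp)

end Localization

/-! ### Top local cohomology -/

section TopLocalCohomology

set_option linter.unusedSectionVars false

variable {S : Type*} [CommRing S] {ι : Type*} [Fintype ι] [DecidableEq ι]

/-- The image of the localization `S_{∏_{j ≠ i} y_j}` in the localization `S_{∏_j y_j}`. -/
def cechFace (y : ι → S) (i : ι) : Submodule S (Localization.Away (∏ j, y j)) where
  carrier := {t | ∃ (k : ℕ) (a : S),
    (∏ j ∈ Finset.univ.erase i, y j) ^ k • t = algebraMap S (Localization.Away (∏ j, y j)) a}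
  zero_mem' := ⟨0, 0, by simp⟩
  add_mem' := by
    rintro s t ⟨k, a, hk⟩ ⟨l, b, hl⟩
    refine ⟨k + l, (∏ j ∈ Finset.univ.erase i, y j) ^ l * a +
      (∏ j ∈ Finset.univ.erase i, y j) ^ k * b, ?_⟩
    rw [map_add, map_mul, map_mul, ← hk, ← hl, ← Algebra.smul_def, ← Algebra.smul_def, smul_add,
      smul_smul, smul_smul, ← pow_add, ← pow_add, add_comm l k]
  smul_mem' := by
    rintro c t ⟨k, a, hk⟩
    exact ⟨k, c * a, by rw [smul_comm, hk, map_mul, Algebra.smul_def]⟩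

/-- The image of the last differential
`⨁_i S_{∏_{j ≠ i} y_j} → S_{∏_j y_j}` of the Čech complex of `S` on the family `y`. -/
def cechBoundary (y : ι → S) : Submodule S (Localization.Away (∏ j, y j)) := ⨆ i, cechFace y i

/-- For a family `y` of `d` elements generating the ideal `I`, the top local cohomology module
`H^d_I(S)`, that is, the cokernel of the last differential of the Čech complex on `y`. -/
def TopLocalCohomology (y : ι → S) : Type _ :=
  Localization.Away (∏ j, y j) ⧸ cechBoundary y

namespace TopLocalCohomology

variable (R : Type*) [CommRing R] [Algebra R S] (y : ι → S)

noncomputable instance : AddCommGroup (TopLocalCohomology y) :=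
  inferInstanceAs (AddCommGroup (Localization.Away (∏ j, y j) ⧸ cechBoundary y))

noncomputable instance : Module S (TopLocalCohomology y) :=
  inferInstanceAs (Module S (Localization.Away (∏ j, y j) ⧸ cechBoundary y))

noncomputable instance : Module R (TopLocalCohomology y) := Module.compHom _ (algebraMap R S)

/-- The class of an element of `S_{∏_j y_j}`. -/
noncomputable def mk : Localization.Away (∏ j, y j) →ₗ[S] TopLocalCohomology y :=
  (cechBoundary y).mkQ

theorem mk_surjective : Function.Surjective (mk y) := (cechBoundary y).mkQ_surjective

/-- The action of `D(S, R)` on `S_{∏_j y_j}`. -/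
noncomputable def actLoc :
    DiffOpRing R S →ₐ[R] Module.End R (Localization.Away (∏ j, y j)) :=
  DiffOpRing.extendHom (Submonoid.powers (∏ j, y j)) _

theorem actLoc_algebraMap (P : DiffOpRing R S) (s : S) :
    actLoc R y P (algebraMap S _ s) = algebraMap S _ (P.1 s) :=
  DiffOpRing.extend_algebraMap (Submonoid.powers (∏ j, y j)) P s

theorem actLoc_mulOp (s : S) (t : Localization.Away (∏ j, y j)) :
    actLoc R y (DiffOpRing.mulOp R S s) t = s • t :=
  LinearMap.congr_fun (DiffOpRing.extend_mulOp (R := R) (Submonoid.powers (∏ j, y j)) s) t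

variable {R y} in
theorem _root_.OrderLT.mem_cechFace {k : ℕ} {Q : Module.End R (Localization.Away (∏ j, y j))}
    (hQ : OrderLT S k Q) (h : ∀ s : S, ∃ s' : S, Q (algebraMap S _ s) = algebraMap S _ s') {i : ι}
    {t : Localization.Away (∏ j, y j)} (ht : t ∈ cechFace y i) : Q t ∈ cechFace y i := by
  induction k generalizing Q with
  | zero =>
    obtain rfl : Q = 0 := hQ
    exact zero_mem _
  | succ k ih =>
    obtain ⟨l, a, ha⟩ := ht
    have h1 := ih (hQ ((∏ j ∈ Finset.univ.erase i, y j) ^ l)) (fun s => by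
      obtain ⟨b, hb⟩ := h ((∏ j ∈ Finset.univ.erase i, y j) ^ l * s)
      obtain ⟨c, hc⟩ := h s
      refine ⟨b - (∏ j ∈ Finset.univ.erase i, y j) ^ l * c, ?_⟩
      rw [actionComm_apply, Algebra.smul_def, ← map_mul, hb, hc, Algebra.smul_def, ← map_mul,
        map_sub])
    rw [actionComm_apply, ha] at h1
    obtain ⟨b, hb⟩ := h a
    have h2 : (∏ j ∈ Finset.univ.erase i, y j) ^ l • Q t ∈ cechFace y i := by
      have h3 : Q (algebraMap S _ a) ∈ cechFace y i := ⟨0, b, by simpa using hb⟩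
      simpa using (cechFace y i).sub_mem h3 h1
    obtain ⟨m, c, hc⟩ := h2
    exact ⟨m + l, c, by rw [← hc, smul_smul, pow_add]⟩

theorem actLoc_mem (P : DiffOpRing R S) {t : Localization.Away (∏ j, y j)}
    (ht : t ∈ cechBoundary y) : actLoc R y P t ∈ cechBoundary y := by
  obtain ⟨k, hk⟩ := DiffOpRing.extend_orderLT (Submonoid.powers (∏ j, y j))
    (T := Localization.Away (∏ j, y j)) P
  induction ht using Submodule.iSup_induction' with
  | mem i t ht =>
    exact Submodule.mem_iSup_of_mem i
      (OrderLT.mem_cechFace hk (fun s => ⟨_, actLoc_algebraMap R y P s⟩) ht)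
  | zero => rw [map_zero]; exact zero_mem _
  | add s t _ _ hs ht => rw [map_add]; exact add_mem hs ht

/-- The `D(S, R)`-module structure on `H^d_I(S)`, induced from the one on `S_{∏_j y_j}`. -/
noncomputable instance : SMul (DiffOpRing R S) (TopLocalCohomology y) where
  smul P := QuotientAddGroup.map (cechBoundary y).toAddSubgroup (cechBoundary y).toAddSubgroup
    (actLoc R y P).toAddMonoidHom fun _ ht => actLoc_mem R y P ht

variable {R} in
theorem smul_mk (P : DiffOpRing R S) (t : Localization.Away (∏ j, y j)) :
    P • mk y t = mk y (actLoc R y P t) := rfl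

noncomputable instance : Module (DiffOpRing R S) (TopLocalCohomology y) where
  one_smul e := by
    obtain ⟨t, rfl⟩ := mk_surjective y e
    rw [smul_mk, map_one, Module.End.one_apply]
  mul_smul P Q e := by
    obtain ⟨t, rfl⟩ := mk_surjective y e
    rw [smul_mk, smul_mk, smul_mk, map_mul, Module.End.mul_apply]
  smul_zero P := by rw [← map_zero (mk y), smul_mk, map_zero]
  smul_add P e e' := by
    obtain ⟨t, rfl⟩ := mk_surjective y e
    obtain ⟨t', rfl⟩ := mk_surjective y e'
    rw [← map_add, smul_mk, smul_mk, smul_mk, map_add, map_add]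
  add_smul P Q e := by
    obtain ⟨t, rfl⟩ := mk_surjective y e
    rw [smul_mk, smul_mk, smul_mk, map_add, LinearMap.add_apply, map_add]
  zero_smul e := by
    obtain ⟨t, rfl⟩ := mk_surjective y e
    rw [smul_mk, map_zero, LinearMap.zero_apply, map_zero]

/-- The `D(S, R)`-module structure extends the `S`-module structure. -/
theorem mulOp_smul (s : S) (e : TopLocalCohomology y) : DiffOpRing.mulOp R S s • e = s • e := by
  obtain ⟨t, rfl⟩ := mk_surjective y e
  rw [smul_mk, actLoc_mulOp, map_smul]

instance : IsScalarTower R (DiffOpRing R S) (TopLocalCohomology y) where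
  smul_assoc r P e := by
    have h : r • P = DiffOpRing.mulOp R S (algebraMap R S r) * P := by
      ext s
      simp [DiffOpRing.mulOp, Algebra.smul_def]
    rw [h, mul_smul, mulOp_smul]
    rfl

instance : SMulCommClass (DiffOpRing R S) R (TopLocalCohomology y) where
  smul_comm P r e := by
    rw [← one_smul (DiffOpRing R S) e, ← smul_assoc r (1 : DiffOpRing R S), smul_smul, smul_smul,
      mul_smul_comm, mul_one]
    exact smul_assoc r P e

end TopLocalCohomology

end TopLocalCohomology

/-! ### Injective hulls -/

/-- `E` is an injective hull of the `A`-module `M`: it is an injective `A`-module that contains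
(an isomorphic copy of) `M` as an essential submodule. -/
def IsInjectiveHull (A M E : Type*) [CommRing A] [AddCommGroup M] [Module A M] [AddCommGroup E]
    [Module A E] : Prop :=
  Module.Injective A E ∧ ∃ f : M →ₗ[A] E, Function.Injective f ∧
    ∀ N : Submodule A E, N ≠ ⊥ → N ⊓ LinearMap.range f ≠ ⊥

/-! ### The ring `S = V[[x_1, …, x_n]]` and the module `E_S(K)` -/

/-- The family `p, x_1, …, x_n` in `V[[x_1, …, x_n]]`. -/
noncomputable def paramSystem (V : Type*) [CommRing V] (p n : ℕ) :
    Option (Fin n) → MvPowerSeries (Fin n) V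
  | none => (p : MvPowerSeries (Fin n) V)
  | some i => MvPowerSeries.X i

/-- The module `E_S(K)`, realised as `H^{n+1}_m(S)` for `S = V[[x_1, …, x_n]]` and
`m = (p, x_1, …, x_n)`, with its natural `D(S, V)`-module structure. -/
abbrev HullModule (V : Type*) [CommRing V] (p n : ℕ) : Type _ :=
  TopLocalCohomology (paramSystem V p n)

/-! Write `x = x_1 ⋯ x_n`. Every element of `E` is a fraction `s / (p x)^(K+1)`, and it is zero
exactly when `p^(K+1)` divides every coefficient of `s` with exponents in the box `[0, K]^n`
(`smul_invGen_eq_zero_iff`). So over `V` the module is a direct sum of copies of `Frac V / V`, one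
for each monomial in the `x_i` with all exponents negative. All three claims come from this
description.

(i) Let `res : E → Frac V / V` read off the coefficient of `1 / x`. The pairing `(t, e) ↦ res (t e)`
is nondegenerate, and it represents every `V`-linear functional on `S` that kills multiples of high
powers of the parameters. Given `g : I → E`, Artin–Rees shows that `g` kills `I ∩ m^N` for some `N`.
Then `res ∘ g` extends to `S / m^N`, because `Frac V / V` is injective over the PID `V`. The element
representing the extension also represents `g` (`HullModule.baer`). The class of `1 / (p x)` spans
the socle, and every nonzero element has it as a multiple.

(ii) Divided derivatives turn `1 / x_i` into `± 1 / x_i^(t+1)` with no other integer factor. Hence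
`1 / (p^(l+1) x)` generates the whole annihilator of `p^(l+1)` over the differential operators
(`mem_of_socleGen_mem`). If a submodule has an element not killed by `p^l`, it contains `1 /
(p^(l+1) x)` (`socleGen_mem_of_smul_ne_zero`). It is therefore everything, or the annihilator of the
least power of `p` that kills it.

(iii) An endomorphism is `S`-linear, so it scales each `1 / (p^(l+1) x)` by some `a_l`. The `a_l`
are compatible modulo `p^(l+1)`, hence converge to some `b`. The kernel of the difference with `b`
is a submodule containing all these classes, so it is everything. -/

/-! ### Power series and boxes of exponents -/

section BoxDecomposition

variable {V : Type*} [CommRing V] {n : ℕ}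

/-- The exponent vector all of whose entries are `k`. -/
noncomputable def constExp (n k : ℕ) : Fin n →₀ ℕ := Finsupp.equivFunOnFinite.symm fun _ => k

@[simp] theorem constExp_apply (k : ℕ) (i : Fin n) : constExp n k i = k := rfl

theorem le_constExp {k : ℕ} {b : Fin n →₀ ℕ} : b ≤ constExp n k ↔ ∀ i, b i ≤ k := Iff.rfl

theorem constExp_add (k l : ℕ) : constExp n (k + l) = constExp n k + constExp n l := by
  ext; simp

theorem mul_constExp_one (k : ℕ) : k • constExp n 1 = constExp n k := by ext; simp

/-- A power series whose coefficients in the box `[0, K]^n` vanish lies in the ideal generated by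
the `X_i ^ (K + 1)`. -/
theorem MvPowerSeries.exists_eq_sum_X_pow_mul {K : ℕ} {s : MvPowerSeries (Fin n) V}
    (h : ∀ b ≤ constExp n K, MvPowerSeries.coeff b s = 0) :
    ∃ g : Fin n → MvPowerSeries (Fin n) V, s = ∑ i, MvPowerSeries.X i ^ (K + 1) * g i := by
  classical
  have hex : ∀ b : Fin n →₀ ℕ, ¬ b ≤ constExp n K → ∃ i, K < b i := fun b hb => by
    simpa [le_constExp] using hb
  -- Each exponent outside the box is charged to a single variable that leaves it, so `s` splits
  -- into parts with disjoint supports.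
  let c : (Fin n →₀ ℕ) → Option (Fin n) := fun b =>
    if hb : ¬ b ≤ constExp n K then some (hex b hb).choose else none
  have hc : ∀ b i, c b = some i → K < b i := by
    intro b i hbi
    simp only [c] at hbi
    split_ifs at hbi with hb
    rw [Option.some.injEq] at hbi
    exact hbi ▸ (hex b hb).choose_spec
  let part : Fin n → MvPowerSeries (Fin n) V := fun i b =>
    if c b = some i then MvPowerSeries.coeff b s else 0
  have hpart : ∀ i b, MvPowerSeries.coeff b (part i) =
      if c b = some i then MvPowerSeries.coeff b s else 0 := fun _ _ => rfl
  have hdvd : ∀ i, MvPowerSeries.X i ^ (K + 1) ∣ part i := fun i => by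
    rw [MvPowerSeries.X_pow_dvd_iff]
    intro b hb
    rw [hpart, if_neg]
    intro hci
    have := hc b i hci
    omega
  choose g hg using hdvd
  refine ⟨g, ?_⟩
  simp_rw [← hg]
  ext b
  rw [map_sum]
  simp_rw [hpart]
  cases hcb : c b with
  | none =>
    have hb : b ≤ constExp n K := by
      by_contra hb
      simp [c, hb] at hcb
    simp [h b hb]
  | some i => simp

/-- A power series whose coefficients in the box `[0, K]^n` are divisible by `a` lies in the ideal
generated by `a` and the `X_i ^ (K + 1)`. -/
theorem MvPowerSeries.exists_eq_smul_add_sum {K : ℕ} {a : V} {s : MvPowerSeries (Fin n) V}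
    (h : ∀ b ≤ constExp n K, a ∣ MvPowerSeries.coeff b s) :
    ∃ (t : MvPowerSeries (Fin n) V) (g : Fin n → MvPowerSeries (Fin n) V),
      s = MvPowerSeries.C a * t + ∑ i, MvPowerSeries.X i ^ (K + 1) * g i := by
  classical
  choose q hq using h
  let t : MvPowerSeries (Fin n) V := fun b => if hb : b ≤ constExp n K then q b hb else 0
  have ht : ∀ b (hb : b ≤ constExp n K), MvPowerSeries.coeff b t = q b hb := fun b hb =>
    dif_pos hb
  obtain ⟨g, hg⟩ := MvPowerSeries.exists_eq_sum_X_pow_mul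
    (s := s - MvPowerSeries.C a * t) (K := K) (fun b hb => by
      rw [map_sub, MvPowerSeries.coeff_C_mul, ht b hb, ← hq b hb, sub_self])
  exact ⟨t, g, by rw [← hg]; ring⟩

end BoxDecomposition

/-! ### Fractions with denominator `(p x)^(K+1)` and when they vanish -/

namespace HullModule

section Generators

variable (V : Type*) [CommRing V] (p n : ℕ)

/-- The product `p x_1 ⋯ x_n` of the parameters. -/
noncomputable def paramProd : MvPowerSeries (Fin n) V := ∏ j, paramSystem V p n j

variable {V p n}

theorem natCast_eq_C (a : ℕ) : ((a : ℕ) : MvPowerSeries (Fin n) V) = MvPowerSeries.C (a : V) :=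
  (map_natCast (MvPowerSeries.C (σ := Fin n) (R := V)) a).symm

theorem prod_X_pow (k : ℕ) (A : Finset (Fin n)) :
    ∏ i ∈ A, (MvPowerSeries.X i : MvPowerSeries (Fin n) V) ^ k =
      MvPowerSeries.monomial (∑ i ∈ A, Finsupp.single i k) 1 := by
  simp_rw [MvPowerSeries.X_pow_eq, MvPowerSeries.prod_monomial]
  simp

theorem sum_single_eq_constExp (k : ℕ) : ∑ i : Fin n, Finsupp.single i k = constExp n k := by
  ext j
  simp [Finsupp.finsetSum_apply, Finsupp.single_apply]

theorem paramProd_eq : paramProd V p n = MvPowerSeries.monomial (constExp n 1) (p : V) := by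
  have h := prod_X_pow (V := V) (n := n) 1 Finset.univ
  simp only [pow_one] at h
  rw [paramProd, Fintype.prod_option]
  change (p : MvPowerSeries (Fin n) V) * ∏ i, MvPowerSeries.X i = _
  rw [h, sum_single_eq_constExp, natCast_eq_C, ← MvPowerSeries.monomial_zero_eq_C_apply,
    MvPowerSeries.monomial_mul_monomial, zero_add, mul_one]

theorem paramProd_pow (k : ℕ) :
    paramProd V p n ^ k = MvPowerSeries.monomial (constExp n k) ((p : V) ^ k) := by
  rw [paramProd_eq, MvPowerSeries.monomial_pow, mul_constExp_one]

theorem coeff_paramProd_pow_mul (k : ℕ) (b : Fin n →₀ ℕ) (s : MvPowerSeries (Fin n) V) :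
    MvPowerSeries.coeff (constExp n k + b) (paramProd V p n ^ k * s) =
      (p : V) ^ k * MvPowerSeries.coeff b s := by
  rw [paramProd_pow, MvPowerSeries.coeff_add_monomial_mul]

variable (V p n)

/-- The localization `S_{p x_1 ⋯ x_n}`. -/
abbrev ParamLoc : Type _ := Localization.Away (∏ j, paramSystem V p n j)

/-- The element `1 / (p x_1 ⋯ x_n)` of the localization. -/
noncomputable def invProd : ParamLoc V p n :=
  IsLocalization.Away.invSelf (∏ j, paramSystem V p n j)

variable {V p n}

theorem algebraMap_paramProd_mul_invProd :
    algebraMap _ (ParamLoc V p n) (paramProd V p n) * invProd V p n = 1 :=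
  IsLocalization.Away.mul_invSelf (∏ j, paramSystem V p n j)

variable (V p n)

/-- The class of `1 / (p x_1 ⋯ x_n) ^ (K + 1)`. -/
noncomputable def invGen (K : ℕ) : HullModule V p n :=
  TopLocalCohomology.mk (paramSystem V p n) (invProd V p n ^ (K + 1))

variable {V p n}

theorem paramProd_pow_smul_invProd_pow (k K : ℕ) :
    paramProd V p n ^ k • invProd V p n ^ (k + K) = invProd V p n ^ K := by
  rw [Algebra.smul_def, pow_add, ← mul_assoc, map_pow, ← mul_pow,
    algebraMap_paramProd_mul_invProd, one_pow, one_mul]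

theorem paramProd_pow_smul_invGen (k K : ℕ) :
    paramProd V p n ^ k • invGen V p n (k + K) = invGen V p n K := by
  rw [invGen, ← map_smul, add_assoc, paramProd_pow_smul_invProd_pow, invGen]

/-- Any sufficiently large exponent is allowed, so that several elements can be put over a common
denominator. -/
theorem exists_smul_invGen (e : HullModule V p n) :
    ∃ K₀, ∀ K ≥ K₀, ∃ s : MvPowerSeries (Fin n) V, e = s • invGen V p n K := by
  obtain ⟨t, rfl⟩ := TopLocalCohomology.mk_surjective _ e
  obtain ⟨⟨s, w, k, rfl⟩, hs⟩ := IsLocalization.surj (Submonoid.powers (∏ j, paramSystem V p n j)) t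
  refine ⟨k, fun K hK => ⟨paramProd V p n ^ (K + 1 - k) * s, ?_⟩⟩
  rw [invGen, ← map_smul]
  congr 1
  have h1 : t = s • invProd V p n ^ k := by
    have h2 : (algebraMap _ (ParamLoc V p n) (paramProd V p n) * invProd V p n) ^ k = 1 := by
      rw [algebraMap_paramProd_mul_invProd, one_pow]
    rw [mul_pow, ← map_pow] at h2
    calc t = t * 1 := (mul_one t).symm
      _ = (t * algebraMap _ (ParamLoc V p n) (paramProd V p n ^ k)) * invProd V p n ^ k := by
        rw [mul_assoc, h2]
      _ = _ := by rw [Algebra.smul_def]; exact congrArg (· * _) hs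
  obtain ⟨j, hj⟩ := Nat.exists_eq_add_of_le (show k ≤ K + 1 by omega)
  rw [hj, Nat.add_sub_cancel_left, mul_comm, mul_smul, add_comm k j,
    paramProd_pow_smul_invProd_pow, h1]

theorem exists_pair_smul_invGen (e e' : HullModule V p n) :
    ∃ K₀, ∀ K ≥ K₀, ∃ s s' : MvPowerSeries (Fin n) V,
      e = s • invGen V p n K ∧ e' = s' • invGen V p n K := by
  obtain ⟨K₁, h₁⟩ := exists_smul_invGen e
  obtain ⟨K₂, h₂⟩ := exists_smul_invGen e'
  refine ⟨max K₁ K₂, fun K hK => ?_⟩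
  obtain ⟨s, hs⟩ := h₁ K (by omega)
  obtain ⟨s', hs'⟩ := h₂ K (by omega)
  exact ⟨s, s', hs, hs'⟩

theorem paramSystem_pow_smul_invGen (i : Option (Fin n)) (K : ℕ) :
    paramSystem V p n i ^ (K + 1) • invGen V p n K = 0 := by
  rw [invGen, ← map_smul]
  refine (Submodule.Quotient.mk_eq_zero _).2 (Submodule.mem_iSup_of_mem i ⟨K + 1, 1, ?_⟩)
  rw [smul_smul, ← mul_pow, Finset.prod_erase_mul _ _ (Finset.mem_univ i)]
  exact (paramProd_pow_smul_invProd_pow (K + 1) 0).trans (by simp)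

theorem X_pow_smul_invGen (i : Fin n) (K : ℕ) :
    (MvPowerSeries.X i : MvPowerSeries (Fin n) V) ^ (K + 1) • invGen V p n K = 0 :=
  paramSystem_pow_smul_invGen (some i) K

theorem C_pow_smul_invGen (K : ℕ) :
    (MvPowerSeries.C ((p : V) ^ (K + 1)) : MvPowerSeries (Fin n) V) • invGen V p n K = 0 := by
  rw [map_pow, ← natCast_eq_C]
  exact paramSystem_pow_smul_invGen none K

/-- Only the box coefficients of the numerator matter: the rest lies in the ideal of the
`X_i^(K+1)`, which kills the fraction. -/
theorem exists_smul_invGen_eq_of_dvd {K : ℕ} {a : V} {s : MvPowerSeries (Fin n) V}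
    (h : ∀ b ≤ constExp n K, a ∣ MvPowerSeries.coeff b s) :
    ∃ t : MvPowerSeries (Fin n) V,
      s • invGen V p n K = t • (MvPowerSeries.C a : MvPowerSeries (Fin n) V) • invGen V p n K := by
  obtain ⟨t, g, rfl⟩ := MvPowerSeries.exists_eq_smul_add_sum h
  refine ⟨t, ?_⟩
  rw [add_smul, Finset.sum_smul, Finset.sum_eq_zero, add_zero, mul_comm, mul_smul]
  intro i _
  rw [mul_comm, mul_smul, X_pow_smul_invGen, smul_zero]

/-- A vanishing fraction is a sum of elements of the Čech faces. Clearing denominators gives an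
identity `(p x)^m s = ∑ y_i^k' a'_i` in `S`, where the required divisibility can be read off one
coefficient at a time. -/
theorem pow_dvd_coeff_of_smul_invGen_eq_zero [IsDomain V] (hp : (p : V) ≠ 0) {K : ℕ}
    {s : MvPowerSeries (Fin n) V} (h : s • invGen V p n K = 0) {b : Fin n →₀ ℕ}
    (hb : b ≤ constExp n K) : (p : V) ^ (K + 1) ∣ MvPowerSeries.coeff b s := by
  have hf : ∏ j, paramSystem V p n j ≠ 0 := by
    change paramProd V p n ≠ 0
    intro h0
    have h1 := congrArg (MvPowerSeries.coeff (constExp n 1)) h0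
    rw [paramProd_eq, MvPowerSeries.coeff_monomial_same, map_zero] at h1
    exact hp h1
  have hinj : Function.Injective (algebraMap (MvPowerSeries (Fin n) V) (ParamLoc V p n)) :=
    IsLocalization.injective _ (powers_le_nonZeroDivisors_of_noZeroDivisors hf)
  rw [invGen, ← map_smul] at h
  have h1 : s • invProd V p n ^ (K + 1) ∈ cechBoundary (paramSystem V p n) :=
    (Submodule.Quotient.mk_eq_zero _).1 h
  rw [cechBoundary, Submodule.mem_iSup_iff_exists_finsupp] at h1
  obtain ⟨t, ht, hsum⟩ := h1
  rw [Finsupp.sum_fintype _ _ (fun _ => rfl)] at hsum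
  choose k a hka using ht
  obtain ⟨m, hm⟩ : ∃ m, ∀ i, k i ≤ m := ⟨_, fun i =>
    Finset.single_le_sum (f := k) (fun _ _ => Nat.zero_le _) (Finset.mem_univ i)⟩
  -- The exponent clears the denominators of all the `t i` and leaves `(p x)^m s` on the other side;
  -- it also exceeds `m + b i` for every `b` in the box.
  let k' : ℕ := K + 1 + m
  have hk' : ∀ i, k i ≤ k' := fun i => (hm i).trans (Nat.le_add_left _ _)
  have hface : ∀ i, ∃ a' : MvPowerSeries (Fin n) V, paramProd V p n ^ k' • t i =
      algebraMap _ (ParamLoc V p n) (paramSystem V p n i ^ k' * a') := by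
    intro i
    refine ⟨(∏ j ∈ Finset.univ.erase i, paramSystem V p n j) ^ (k' - k i) * a i, ?_⟩
    have hprod : paramProd V p n =
        paramSystem V p n i * ∏ j ∈ Finset.univ.erase i, paramSystem V p n j :=
      (Finset.mul_prod_erase _ _ (Finset.mem_univ i)).symm
    rw [hprod, mul_pow, mul_smul, map_mul,
      map_mul, ← hka, ← Algebra.smul_def, ← Algebra.smul_def, smul_smul
        ((∏ j ∈ Finset.univ.erase i, paramSystem V p n j) ^ (k' - k i)), ← pow_add,
      Nat.sub_add_cancel (hk' i)]
  choose a' ha' using hface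
  have key : paramProd V p n ^ m * s = ∑ i, paramSystem V p n i ^ k' * a' i := by
    apply hinj
    rw [map_sum]
    simp_rw [← ha']
    rw [← Finset.smul_sum, hsum, smul_comm, show k' = m + (K + 1) from add_comm _ _,
      pow_add, mul_smul]
    have h2 := paramProd_pow_smul_invProd_pow (V := V) (p := p) (n := n) (K + 1) 0
    rw [add_zero, pow_zero] at h2
    rw [h2, Algebra.smul_def s, Algebra.smul_def, map_mul, mul_one, mul_comm]
  -- At exponent `m + b` the terms `x_i^k' a'_i` contribute nothing, so only the multiple of `p^k'`
  -- remains, and `p^m` cancels.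
  have h3 := congrArg (MvPowerSeries.coeff (constExp n m + b)) key
  rw [coeff_paramProd_pow_mul, Fintype.sum_option, map_add, map_sum, Finset.sum_eq_zero,
    add_zero] at h3
  · change _ = MvPowerSeries.coeff _ ((p : MvPowerSeries (Fin n) V) ^ k' * _) at h3
    rw [natCast_eq_C, ← map_pow, MvPowerSeries.coeff_C_mul, show k' = m + (K + 1) from
      add_comm _ _, pow_add, mul_assoc] at h3
    exact ⟨_, mul_left_cancel₀ (pow_ne_zero _ hp) h3⟩
  · intro i _
    refine MvPowerSeries.X_pow_dvd_iff.1 (Dvd.intro _ rfl) _ ?_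
    have := le_constExp.1 hb i
    simp only [Finsupp.add_apply, constExp_apply, k']
    omega

theorem smul_invGen_eq_zero_iff [IsDomain V] (hp : (p : V) ≠ 0) {K : ℕ}
    {s : MvPowerSeries (Fin n) V} : s • invGen V p n K = 0 ↔
      ∀ b ≤ constExp n K, (p : V) ^ (K + 1) ∣ MvPowerSeries.coeff b s := by
  refine ⟨fun h b hb => pow_dvd_coeff_of_smul_invGen_eq_zero hp h hb, fun h => ?_⟩
  obtain ⟨t, ht⟩ := exists_smul_invGen_eq_of_dvd (p := p) h
  rw [ht, C_pow_smul_invGen, smul_zero]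

end Generators

end HullModule

/-! ### The classes `1 / (p^(l+1) x)` and the annihilators of powers of `p` -/

namespace HullModule

section SocleGenerators

variable (V : Type*) [CommRing V] (p n : ℕ)

/-- The class of `1 / (p ^ (l + 1) x_1 ⋯ x_n)`. -/
noncomputable def socleGen (l : ℕ) : HullModule V p n :=
  (MvPowerSeries.monomial (constExp n l) 1 : MvPowerSeries (Fin n) V) • invGen V p n l

variable {V p n}

theorem socleGen_eq {K l : ℕ} (h : l ≤ K) : socleGen V p n l =
    (MvPowerSeries.monomial (constExp n K) ((p : V) ^ (K - l)) : MvPowerSeries (Fin n) V) •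
      invGen V p n K := by
  obtain ⟨k, rfl⟩ := Nat.exists_eq_add_of_le' h
  rw [socleGen, ← paramProd_pow_smul_invGen k l, smul_smul, paramProd_pow,
    MvPowerSeries.monomial_mul_monomial, one_mul, Nat.add_sub_cancel, ← constExp_add, add_comm l k]

theorem C_smul_socleGen_eq {K l : ℕ} (h : l ≤ K) (v : V) :
    (MvPowerSeries.C v : MvPowerSeries (Fin n) V) • socleGen V p n l =
      (MvPowerSeries.monomial (constExp n K) ((p : V) ^ (K - l) * v) : MvPowerSeries (Fin n) V) •
        invGen V p n K := by
  rw [socleGen_eq h, smul_smul, ← MvPowerSeries.monomial_zero_eq_C_apply,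
    MvPowerSeries.monomial_mul_monomial, zero_add, mul_comm]

theorem C_pow_smul_socleGen (k l : ℕ) :
    (MvPowerSeries.C ((p : V) ^ k) : MvPowerSeries (Fin n) V) • socleGen V p n (k + l) =
      socleGen V p n l := by
  rw [C_smul_socleGen_eq le_rfl, socleGen_eq (Nat.le_add_left l k)]
  simp

theorem X_smul_socleGen (i : Fin n) (l : ℕ) :
    (MvPowerSeries.X i : MvPowerSeries (Fin n) V) • socleGen V p n l = 0 := by
  have h : (MvPowerSeries.X i : MvPowerSeries (Fin n) V) ^ (l + 1) ∣
      MvPowerSeries.X i * MvPowerSeries.monomial (constExp n l) 1 := by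
    rw [MvPowerSeries.X_pow_dvd_iff]
    intro b hb
    classical
    rw [MvPowerSeries.X, MvPowerSeries.monomial_mul_monomial, MvPowerSeries.coeff_monomial,
      if_neg]
    rintro rfl
    simp at hb
  obtain ⟨g, hg⟩ := h
  rw [socleGen, smul_smul, hg, mul_comm, mul_smul, X_pow_smul_invGen, smul_zero]

variable [IsDomain V]

theorem C_smul_socleGen_eq_zero_iff (hp : (p : V) ≠ 0) {l : ℕ} {v : V} :
    (MvPowerSeries.C v : MvPowerSeries (Fin n) V) • socleGen V p n l = 0 ↔
      (p : V) ^ (l + 1) ∣ v := by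
  classical
  rw [C_smul_socleGen_eq le_rfl, smul_invGen_eq_zero_iff hp]
  constructor
  · intro h
    simpa [MvPowerSeries.coeff_monomial] using h _ le_rfl
  · intro h b _
    rw [MvPowerSeries.coeff_monomial]
    split_ifs
    · simpa using h
    · exact dvd_zero _

/-- Over a denominator with exponent `K + 1`, being killed by every `X_i` makes all box coefficients
except the one at the corner `(K, …, K)` irrelevant. Being killed by `p^(l+1)` makes the corner
coefficient divisible by `p^(K-l)`. -/
theorem exists_eq_C_smul_socleGen (hp : (p : V) ≠ 0) {l : ℕ} {e : HullModule V p n}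
    (hX : ∀ i, (MvPowerSeries.X i : MvPowerSeries (Fin n) V) • e = 0)
    (hl : (MvPowerSeries.C ((p : V) ^ (l + 1)) : MvPowerSeries (Fin n) V) • e = 0) :
    ∃ v : V, e = (MvPowerSeries.C v : MvPowerSeries (Fin n) V) • socleGen V p n l := by
  classical
  obtain ⟨K₀, hK₀⟩ := exists_smul_invGen e
  obtain ⟨s, rfl⟩ := hK₀ (K₀ + l) (by omega)
  simp_rw [smul_smul, smul_invGen_eq_zero_iff hp] at hX hl
  have h1 := hl _ le_rfl
  rw [MvPowerSeries.coeff_C_mul, show K₀ + l + 1 = (l + 1) + K₀ by ring, pow_add] at h1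
  obtain ⟨v, hv⟩ := (mul_dvd_mul_iff_left (pow_ne_zero _ hp)).1 h1
  refine ⟨v, ?_⟩
  rw [C_smul_socleGen_eq (Nat.le_add_left l K₀), ← sub_eq_zero, ← sub_smul,
    smul_invGen_eq_zero_iff hp]
  intro b hb
  rw [map_sub, MvPowerSeries.coeff_monomial]
  split_ifs with hbK
  · rw [hbK, hv, Nat.add_sub_cancel, sub_self]
    exact dvd_zero _
  · rw [sub_zero]
    obtain ⟨i, hi⟩ : ∃ i, b i < K₀ + l := by
      by_contra! hcon
      exact hbK (le_antisymm hb hcon)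
    have h2 := hX i (Finsupp.single i 1 + b) (fun j => by
      have := hb j
      simp only [constExp_apply] at this ⊢
      by_cases hij : i = j
      · subst hij; simp; omega
      · simpa [Finsupp.single_apply, hij] using this)
    rwa [MvPowerSeries.X, MvPowerSeries.coeff_add_monomial_mul, one_mul] at h2

/-- The annihilator of `p^(l+1)` consists of multiples of fractions `1 / (p^(l+1) x^(K+1))`:
cancelling in the vanishing criterion shows that `p^(K-l)` divides all box coefficients. -/
theorem exists_eq_smul_C_smul_invGen (hp : (p : V) ≠ 0) {l : ℕ} {e : HullModule V p n}
    (hl : (MvPowerSeries.C ((p : V) ^ (l + 1)) : MvPowerSeries (Fin n) V) • e = 0) :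
    ∃ (K : ℕ) (t : MvPowerSeries (Fin n) V), l ≤ K ∧
      e = t • (MvPowerSeries.C ((p : V) ^ (K - l)) : MvPowerSeries (Fin n) V) •
        invGen V p n K := by
  obtain ⟨K₀, hK₀⟩ := exists_smul_invGen e
  obtain ⟨s, rfl⟩ := hK₀ (K₀ + l) (by omega)
  rw [smul_smul, smul_invGen_eq_zero_iff hp] at hl
  obtain ⟨t, ht⟩ := exists_smul_invGen_eq_of_dvd (p := p) (s := s) (K := K₀ + l)
    (a := (p : V) ^ K₀) (fun b hb => by
      have h1 := hl b hb
      rw [MvPowerSeries.coeff_C_mul, show K₀ + l + 1 = (l + 1) + K₀ by ring, pow_add] at h1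
      exact (mul_dvd_mul_iff_left (pow_ne_zero _ hp)).1 h1)
  exact ⟨K₀ + l, t, Nat.le_add_left _ _, by rw [ht, Nat.add_sub_cancel]⟩

end SocleGenerators

/-! ### Torsion and the socle -/

section Torsion

variable {V : Type*} [CommRing V] {p n : ℕ}

theorem exists_pow_smul_eq_zero (i : Option (Fin n)) (e : HullModule V p n) :
    ∃ k, paramSystem V p n i ^ k • e = 0 := by
  obtain ⟨K₀, hK₀⟩ := exists_smul_invGen e
  obtain ⟨s, rfl⟩ := hK₀ K₀ le_rfl
  exact ⟨K₀ + 1, by rw [smul_comm, paramSystem_pow_smul_invGen, smul_zero]⟩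

theorem exists_C_pow_smul_eq_zero (e : HullModule V p n) :
    ∃ l, (MvPowerSeries.C ((p : V) ^ (l + 1)) : MvPowerSeries (Fin n) V) • e = 0 := by
  obtain ⟨K₀, hK₀⟩ := exists_smul_invGen e
  obtain ⟨s, rfl⟩ := hK₀ K₀ le_rfl
  exact ⟨K₀, by rw [smul_comm, C_pow_smul_invGen, smul_zero]⟩

variable [IsLocalRing V]

theorem mem_maximalIdeal_iff {s : MvPowerSeries (Fin n) V} :
    s ∈ IsLocalRing.maximalIdeal (MvPowerSeries (Fin n) V) ↔
      MvPowerSeries.constantCoeff s ∈ IsLocalRing.maximalIdeal V := by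
  rw [IsLocalRing.mem_maximalIdeal, IsLocalRing.mem_maximalIdeal, mem_nonunits_iff,
    mem_nonunits_iff, MvPowerSeries.isUnit_iff_constantCoeff]

theorem maximalIdeal_eq_span (hp : IsLocalRing.maximalIdeal V = Ideal.span {(p : V)}) :
    IsLocalRing.maximalIdeal (MvPowerSeries (Fin n) V) =
      Ideal.span (Set.range (paramSystem V p n)) := by
  apply le_antisymm
  · intro s hs
    rw [mem_maximalIdeal_iff, hp, Ideal.mem_span_singleton] at hs
    obtain ⟨t, g, rfl⟩ := MvPowerSeries.exists_eq_smul_add_sum (K := 0) (a := (p : V)) (s := s)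
      (fun b hb => by
        obtain rfl : b = 0 := le_antisymm (fun i => hb i) zero_le
        exact hs)
    refine Ideal.add_mem _ (Ideal.mul_mem_right _ _ ?_)
      (Ideal.sum_mem _ fun i _ => Ideal.mul_mem_right _ _ ?_)
    · exact Ideal.subset_span ⟨none, natCast_eq_C p⟩
    · exact Ideal.subset_span ⟨some i, (pow_one _).symm⟩
  · rw [Ideal.span_le]
    rintro _ ⟨i | i, rfl⟩
    · rw [SetLike.mem_coe, mem_maximalIdeal_iff, hp]
      change MvPowerSeries.constantCoeff ((p : ℕ) : MvPowerSeries (Fin n) V) ∈ _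
      rw [map_natCast]
      exact Ideal.mem_span_singleton_self _
    · rw [SetLike.mem_coe, mem_maximalIdeal_iff]
      change MvPowerSeries.constantCoeff (MvPowerSeries.X i) ∈ _
      rw [MvPowerSeries.constantCoeff_X]
      exact Ideal.zero_mem _

theorem paramSystem_mem_maximalIdeal (hp : IsLocalRing.maximalIdeal V = Ideal.span {(p : V)})
    (i : Option (Fin n)) :
    paramSystem V p n i ∈ IsLocalRing.maximalIdeal (MvPowerSeries (Fin n) V) := by
  rw [maximalIdeal_eq_span hp]
  exact Ideal.subset_span ⟨i, rfl⟩

/-- Every finitely generated submodule is killed by a power of the maximal ideal. -/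
theorem exists_maximalIdeal_pow_le_annihilator
    (hp : IsLocalRing.maximalIdeal V = Ideal.span {(p : V)})
    {M : Submodule (MvPowerSeries (Fin n) V) (HullModule V p n)} (hM : M.FG) :
    ∃ k, IsLocalRing.maximalIdeal (MvPowerSeries (Fin n) V) ^ k ≤ M.annihilator := by
  have hfg : (IsLocalRing.maximalIdeal (MvPowerSeries (Fin n) V)).FG := by
    rw [maximalIdeal_eq_span hp]
    exact ⟨(Set.finite_range (paramSystem V p n)).toFinset, by simp⟩
  -- It suffices that each parameter acts nilpotently on each generator.
  refine Ideal.exists_pow_le_of_le_radical_of_fg ?_ hfg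
  induction M, hM using Submodule.fg_induction with
  | singleton e =>
    rw [maximalIdeal_eq_span hp, Ideal.span_le]
    rintro _ ⟨i, rfl⟩
    obtain ⟨k, hk⟩ := exists_pow_smul_eq_zero i e
    exact ⟨k, (Submodule.mem_annihilator_span_singleton _ _).2 hk⟩
  | sup M₁ M₂ _ _ h₁ h₂ =>
    rw [Submodule.annihilator_sup, Ideal.radical_inf]
    exact le_inf h₁ h₂

/-- Take the last power of the maximal ideal that does not kill `e`. A nonzero `r • e` with `r` in
that power is killed by all parameters, so it is `v / (p x)`, and `v` is a unit because `p / (p x)`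
is zero. -/
theorem exists_smul_eq_socleGen_zero [IsDomain V] (hp0 : (p : V) ≠ 0)
    (hp : IsLocalRing.maximalIdeal V = Ideal.span {(p : V)}) {e : HullModule V p n} (he : e ≠ 0) :
    ∃ s : MvPowerSeries (Fin n) V, s • e = socleGen V p n 0 := by
  classical
  have hex : ∃ k, ∀ r ∈ IsLocalRing.maximalIdeal (MvPowerSeries (Fin n) V) ^ k, r • e = 0 := by
    obtain ⟨k, hk⟩ := exists_maximalIdeal_pow_le_annihilator hp
      (Submodule.fg_span_singleton e)
    exact ⟨k, fun r hr => (Submodule.mem_annihilator_span_singleton _ _).1 (hk hr)⟩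
  obtain ⟨k, hk⟩ : ∃ k, Nat.find hex = k + 1 := by
    refine Nat.exists_eq_succ_of_ne_zero fun h0 => he ?_
    have := Nat.find_spec hex 1
    rw [h0, pow_zero] at this
    simpa using this
  have hmin := Nat.find_min hex (m := k) (by omega)
  have hspec := Nat.find_spec hex
  rw [hk] at hspec
  push Not at hmin
  obtain ⟨r, hr, hre⟩ := hmin
  have hy : ∀ i, paramSystem V p n i • r • e = 0 := fun i => by
    rw [smul_smul]
    refine hspec _ ?_
    rw [pow_succ']
    exact Ideal.mul_mem_mul (paramSystem_mem_maximalIdeal hp i) hr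
  obtain ⟨v, hv⟩ := exists_eq_C_smul_socleGen hp0 (l := 0) (e := r • e) (fun i => hy (some i))
    (by rw [zero_add, pow_one, ← natCast_eq_C]; exact hy none)
  have hvu : IsUnit v := by
    by_contra hvn
    have h1 : v ∈ IsLocalRing.maximalIdeal V := (IsLocalRing.mem_maximalIdeal v).2 hvn
    rw [hp, Ideal.mem_span_singleton] at h1
    exact hre (by rw [hv, C_smul_socleGen_eq_zero_iff hp0]; simpa using h1)
  obtain ⟨u, rfl⟩ := hvu
  refine ⟨MvPowerSeries.C (↑(u⁻¹ : Vˣ) : V) * r, ?_⟩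
  rw [mul_smul, hv, smul_smul, ← map_mul, Units.inv_mul, map_one, one_smul]

theorem exists_residueField_embedding [IsDomain V] (hp0 : (p : V) ≠ 0)
    (hp : IsLocalRing.maximalIdeal V = Ideal.span {(p : V)}) :
    ∃ f : IsLocalRing.ResidueField (MvPowerSeries (Fin n) V) →ₗ[MvPowerSeries (Fin n) V]
        HullModule V p n, Function.Injective f ∧
      ∀ N : Submodule (MvPowerSeries (Fin n) V) (HullModule V p n), N ≠ ⊥ →
        N ⊓ LinearMap.range f ≠ ⊥ := by
  have hg0 : socleGen V p n 0 ≠ 0 := fun h0 => by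
    have h1 := (C_smul_socleGen_eq_zero_iff (n := n) hp0 (l := 0) (v := 1)).1
      (by rw [h0, smul_zero])
    have h2 : (1 : V) ∈ IsLocalRing.maximalIdeal V := by
      rw [hp, Ideal.mem_span_singleton]; simpa using h1
    exact (Ideal.ne_top_iff_one _).1 (IsLocalRing.maximalIdeal.isMaximal V).ne_top h2
  have hker : IsLocalRing.maximalIdeal (MvPowerSeries (Fin n) V) ≤
      LinearMap.ker (LinearMap.toSpanSingleton (MvPowerSeries (Fin n) V) _ (socleGen V p n 0)) := by
    rw [maximalIdeal_eq_span hp, Ideal.span_le]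
    rintro _ ⟨i | i, rfl⟩
    · change (p : MvPowerSeries (Fin n) V) • socleGen V p n 0 = 0
      rw [natCast_eq_C, C_smul_socleGen_eq_zero_iff hp0]
      simp
    · exact X_smul_socleGen i 0
  let f : IsLocalRing.ResidueField (MvPowerSeries (Fin n) V) →ₗ[MvPowerSeries (Fin n) V]
      HullModule V p n := Submodule.liftQ _ _ hker
  have hf : ∀ s, f (IsLocalRing.residue _ s) = s • socleGen V p n 0 := fun s => rfl
  refine ⟨f, ?_, ?_⟩
  · rw [injective_iff_map_eq_zero]
    intro a ha
    obtain ⟨s, rfl⟩ := IsLocalRing.residue_surjective a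
    rw [hf] at ha
    rw [IsLocalRing.residue_eq_zero_iff, IsLocalRing.mem_maximalIdeal]
    intro hs
    exact hg0 ((hs.smul_eq_zero).1 ha)
  · intro N hN h0
    obtain ⟨e, heN, he⟩ := N.ne_bot_iff.1 hN
    obtain ⟨s, hs⟩ := exists_smul_eq_socleGen_zero hp0 hp he
    refine hg0 ((Submodule.mem_bot (MvPowerSeries (Fin n) V)).1 (h0 ▸ ⟨?_, ?_⟩))
    · rw [← hs]; exact N.smul_mem s heN
    · exact ⟨IsLocalRing.residue _ 1, by rw [hf, one_smul]⟩

end Torsion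

end HullModule

/-! ### Injectivity of `Frac V / V` -/

/-- A divisible module over a principal ideal domain satisfies Baer's criterion. -/
theorem Module.Baer.of_forall_exists_smul_eq {V M : Type*} [CommRing V] [IsDomain V]
    [IsPrincipalIdealRing V] [AddCommGroup M] [Module V M]
    (h : ∀ a : V, a ≠ 0 → ∀ x : M, ∃ y, a • y = x) : Module.Baer V M := by
  intro I g
  obtain ⟨a, rfl⟩ := (IsPrincipalIdealRing.principal I).principal
  have ha : a ∈ Submodule.span V {a} := Submodule.mem_span_singleton_self a
  obtain ⟨y, hy⟩ : ∃ y, a • y = g ⟨a, ha⟩ := by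
    by_cases h0 : a = 0
    · refine ⟨0, ?_⟩
      have : (⟨a, ha⟩ : Submodule.span V {a}) = 0 := by ext; simp [h0]
      rw [this, map_zero, smul_zero]
    · exact h a h0 _
  refine ⟨LinearMap.toSpanSingleton V M y, fun x hx => ?_⟩
  obtain ⟨c, rfl⟩ := Submodule.mem_span_singleton.1 hx
  rw [LinearMap.toSpanSingleton_apply, smul_assoc, hy, ← map_smul]
  rfl

/-- The quotient of the fraction field of `V` by `V`. -/
abbrev FractionQuotient (V : Type*) [CommRing V] : Type _ :=
  FractionRing V ⧸ LinearMap.range (Algebra.linearMap V (FractionRing V))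

namespace FractionQuotient

variable (V : Type*) [CommRing V] [IsDomain V]

theorem baer [IsPrincipalIdealRing V] : Module.Baer V (FractionQuotient V) := by
  refine Module.Baer.of_forall_exists_smul_eq fun a ha x => ?_
  obtain ⟨x, rfl⟩ := Submodule.mkQ_surjective _ x
  refine ⟨Submodule.mkQ _ ((algebraMap V (FractionRing V) a)⁻¹ * x), ?_⟩
  rw [← map_smul, Algebra.smul_def, mul_inv_cancel_left₀]
  simpa using ha

variable {V}

/-- The class of `v / a`, as a linear function of `v`. -/
noncomputable def divBy (a : V) : V →ₗ[V] FractionQuotient V :=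
  (Submodule.mkQ _).comp
    ((algebraMap V (FractionRing V) a)⁻¹ • Algebra.linearMap V (FractionRing V))

theorem divBy_apply (a v : V) : divBy a v =
    Submodule.mkQ _ ((algebraMap V (FractionRing V) a)⁻¹ * algebraMap V (FractionRing V) v) := rfl

theorem divBy_eq_zero_iff {a v : V} (ha : a ≠ 0) : divBy a v = 0 ↔ a ∣ v := by
  have ha' : algebraMap V (FractionRing V) a ≠ 0 := by simpa using ha
  rw [divBy_apply, Submodule.mkQ_apply, Submodule.Quotient.mk_eq_zero]
  constructor
  · rintro ⟨c, hc⟩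
    refine ⟨c, IsFractionRing.injective V (FractionRing V) ?_⟩
    rw [Algebra.linearMap_apply] at hc
    rw [map_mul, hc, mul_inv_cancel_left₀ ha']
  · rintro ⟨c, rfl⟩
    exact ⟨c, by rw [Algebra.linearMap_apply, map_mul, inv_mul_cancel_left₀ ha']⟩

theorem divBy_mul_mul {a b v : V} (ha : a ≠ 0) : divBy (a * b) (a * v) = divBy b v := by
  have ha' : algebraMap V (FractionRing V) a ≠ 0 := by simpa using ha
  rw [divBy_apply, divBy_apply]
  congr 1
  rw [map_mul, map_mul, mul_inv]
  field_simp

theorem exists_eq_divBy {a : V} (ha : a ≠ 0) {x : FractionQuotient V} (hx : a • x = 0) :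
    ∃ v, x = divBy a v := by
  have ha' : algebraMap V (FractionRing V) a ≠ 0 := by simpa using ha
  obtain ⟨x, rfl⟩ := Submodule.mkQ_surjective _ x
  rw [← map_smul, Submodule.mkQ_apply, Submodule.Quotient.mk_eq_zero] at hx
  obtain ⟨v, hv⟩ := hx
  refine ⟨v, ?_⟩
  rw [Algebra.linearMap_apply, Algebra.smul_def] at hv
  rw [divBy_apply, hv, inv_mul_cancel_left₀ ha']

end FractionQuotient

/-- Linear maps out of a power series ring that kill the multiples of the `X_i ^ (K + 1)` and agree
on the monomials with exponents at most `K` are equal. -/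
theorem MvPowerSeries.linearMap_ext_of_monomial {V M : Type*} [CommRing V] [AddCommGroup M]
    [Module V M] {n K : ℕ} {A B : MvPowerSeries (Fin n) V →ₗ[V] M}
    (hA : ∀ i g, A (MvPowerSeries.X i ^ (K + 1) * g) = 0)
    (hB : ∀ i g, B (MvPowerSeries.X i ^ (K + 1) * g) = 0)
    (h : ∀ b ≤ constExp n K, A (MvPowerSeries.monomial b 1) = B (MvPowerSeries.monomial b 1)) :
    A = B := by
  classical
  ext t
  obtain ⟨g, hg⟩ := MvPowerSeries.exists_eq_sum_X_pow_mul (K := K)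
    (s := t - ∑ b ∈ Finset.Iic (constExp n K),
      MvPowerSeries.coeff b t • MvPowerSeries.monomial b (1 : V)) (fun b hb => by
      rw [map_sub, map_sum, Finset.sum_eq_single b, MvPowerSeries.coeff_smul,
        MvPowerSeries.coeff_monomial_same, mul_one, sub_self]
      · intro c _ hcb
        rw [MvPowerSeries.coeff_smul, MvPowerSeries.coeff_monomial_ne hcb.symm, mul_zero]
      · intro hb'
        exact absurd (Finset.mem_Iic.2 hb) hb')
  rw [sub_eq_iff_eq_add] at hg
  rw [hg]
  simp only [map_add, map_sum, hA, hB, map_smul]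
  congr 1
  exact Finset.sum_congr rfl fun b hb => by rw [h b (Finset.mem_Iic.1 hb)]

/-! ### The residue pairing and injectivity of `E` -/

namespace HullModule

section Pairing

variable {V : Type*} [CommRing V] {p n : ℕ}

theorem smul_eq_C_smul (v : V) (e : HullModule V p n) :
    v • e = (MvPowerSeries.C v : MvPowerSeries (Fin n) V) • e := rfl

instance : IsScalarTower V (MvPowerSeries (Fin n) V) (HullModule V p n) where
  smul_assoc v s e := by
    rw [smul_eq_C_smul, MvPowerSeries.smul_eq_C_mul, mul_smul]

variable [IsDomain V]

open FractionQuotient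

/-- The residue is the coefficient of `1 / x`. Expanding a fraction by `(p x)^k` shifts the corner
and the power of `p` together, so the value does not depend on the representation. -/
theorem exists_residue (hp : (p : V) ≠ 0) : ∃ res : HullModule V p n →ₗ[V] FractionQuotient V,
    ∀ (K : ℕ) (s : MvPowerSeries (Fin n) V), res (s • invGen V p n K) =
      divBy ((p : V) ^ (K + 1)) (MvPowerSeries.coeff (constExp n K) s) := by
  let q : ℕ → MvPowerSeries (Fin n) V →ₗ[V] FractionQuotient V := fun K =>
    (divBy ((p : V) ^ (K + 1))).comp (MvPowerSeries.coeff (constExp n K))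
  have hq : ∀ k K s, q (k + K) (paramProd V p n ^ k * s) = q K s := fun k K s => by
    change divBy _ (MvPowerSeries.coeff _ _) = divBy _ (MvPowerSeries.coeff _ _)
    rw [constExp_add, coeff_paramProd_pow_mul, add_assoc, pow_add,
      divBy_mul_mul (pow_ne_zero _ hp)]
  have hwd : ∀ K K' s s', s • invGen V p n K = s' • invGen V p n K' → q K s = q K' s' := by
    intro K K' s s' h
    -- Both fractions are brought to the denominator exponent `K + K' + 1`, where the vanishing
    -- criterion applies to the difference of numerators.
    rw [← hq K' K s, ← hq K K' s', add_comm K' K, ← sub_eq_zero, ← map_sub]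
    refine (divBy_eq_zero_iff (pow_ne_zero _ hp)).2 ((smul_invGen_eq_zero_iff hp).1 ?_ _ le_rfl)
    have h1 := paramProd_pow_smul_invGen (V := V) (p := p) (n := n) K' K
    have h2 := paramProd_pow_smul_invGen (V := V) (p := p) (n := n) K K'
    rw [add_comm] at h1
    rw [sub_smul, mul_comm, mul_smul, h1, mul_comm, mul_smul, h2, h, sub_self]
  have hex : ∀ e : HullModule V p n, ∃ x, ∀ K s, e = s • invGen V p n K → x = q K s := by
    intro e
    obtain ⟨K₀, hK₀⟩ := exists_smul_invGen e
    obtain ⟨s, hs⟩ := hK₀ K₀ le_rfl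
    exact ⟨q K₀ s, fun K s' hs' => hwd _ _ _ _ (hs ▸ hs')⟩
  choose r hr using hex
  refine ⟨{ toFun := r, map_add' := fun e e' => ?_, map_smul' := fun v e => ?_ },
    fun K s => hr _ K s rfl⟩
  · obtain ⟨K₀, hK₀⟩ := exists_pair_smul_invGen e e'
    obtain ⟨s, s', hs, hs'⟩ := hK₀ K₀ le_rfl
    rw [hr _ _ _ hs, hr _ _ _ hs', ← map_add]
    exact hr _ _ _ (by rw [hs, hs', add_smul])
  · obtain ⟨K₀, hK₀⟩ := exists_smul_invGen e
    obtain ⟨s, hs⟩ := hK₀ K₀ le_rfl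
    rw [hr _ _ _ hs, ← map_smul]
    exact hr _ _ _ (by rw [hs, smul_assoc]; rfl)

variable {res : HullModule V p n →ₗ[V] FractionQuotient V}

/-- Nondegeneracy of the pairing: a monomial multiplier moves any box coefficient into the corner.
-/
theorem eq_zero_of_residue (hp : (p : V) ≠ 0) (hres : ∀ (K : ℕ) (s : MvPowerSeries (Fin n) V),
    res (s • invGen V p n K) =
      divBy ((p : V) ^ (K + 1)) (MvPowerSeries.coeff (constExp n K) s))
    {e : HullModule V p n} (h : ∀ t : MvPowerSeries (Fin n) V, res (t • e) = 0) : e = 0 := by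
  obtain ⟨K₀, hK₀⟩ := exists_smul_invGen e
  obtain ⟨s, rfl⟩ := hK₀ K₀ le_rfl
  rw [smul_invGen_eq_zero_iff hp]
  intro b hb
  have h1 := h (MvPowerSeries.monomial (constExp n K₀ - b) 1)
  rw [smul_smul, hres, divBy_eq_zero_iff (pow_ne_zero _ hp)] at h1
  have h2 := MvPowerSeries.coeff_add_monomial_mul (constExp n K₀ - b) b s (1 : V)
  rw [tsub_add_cancel_of_le hb, one_mul] at h2
  rwa [h2] at h1

theorem exists_residue_representative (hp : (p : V) ≠ 0)
    (hres : ∀ (K : ℕ) (s : MvPowerSeries (Fin n) V), res (s • invGen V p n K) =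
      divBy ((p : V) ^ (K + 1)) (MvPowerSeries.coeff (constExp n K) s))
    {K : ℕ} (φ : MvPowerSeries (Fin n) V →ₗ[V] FractionQuotient V)
    (h : ∀ i t, φ (paramSystem V p n i ^ (K + 1) * t) = 0) :
    ∃ e : HullModule V p n, ∀ t : MvPowerSeries (Fin n) V, φ t = res (t • e) := by
  have hv : ∀ b : Fin n →₀ ℕ, ∃ v, φ (MvPowerSeries.monomial b 1) =
      divBy ((p : V) ^ (K + 1)) v := fun b => by
    refine exists_eq_divBy (pow_ne_zero _ hp) ?_
    rw [← map_smul, MvPowerSeries.smul_eq_C_mul, map_pow, ← natCast_eq_C]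
    exact h none _
  choose v hv using hv
  -- Pairing with the monomial of exponent `b` reads the coefficient of `s` at the corner minus `b`,
  -- so the values are stored in reflected order. Truncated subtraction gives arbitrary values
  -- outside the box, where they do not affect the class.
  let s : MvPowerSeries (Fin n) V := fun d => v (constExp n K - d)
  refine ⟨s • invGen V p n K, ?_⟩
  have key : φ = res.comp ((LinearMap.toSpanSingleton (MvPowerSeries (Fin n) V) _
      (s • invGen V p n K)).restrictScalars V) := by
    refine MvPowerSeries.linearMap_ext_of_monomial (K := K) (fun i => h (some i))
      (fun i g => ?_) (fun b hb => ?_)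
    · change res ((MvPowerSeries.X i ^ (K + 1) * g) • s • invGen V p n K) = 0
      rw [smul_smul, mul_assoc, mul_comm, mul_smul, X_pow_smul_invGen, smul_zero, map_zero]
    · change _ = res ((MvPowerSeries.monomial b 1 : MvPowerSeries (Fin n) V) •
        s • invGen V p n K)
      rw [smul_smul, hres, hv, ← add_tsub_cancel_of_le hb, MvPowerSeries.coeff_add_monomial_mul,
        one_mul]
      congr 1
      change v b = v (constExp n K - (constExp n K - b))
      rw [tsub_tsub_cancel_of_le hb]
  exact fun t => LinearMap.congr_fun key t

theorem baer [IsLocalRing V] [IsPrincipalIdealRing V] (hp0 : (p : V) ≠ 0)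
    (hp : IsLocalRing.maximalIdeal V = Ideal.span {(p : V)}) :
    Module.Baer (MvPowerSeries (Fin n) V) (HullModule V p n) := by
  intro I g
  obtain ⟨res, hres⟩ := exists_residue (p := p) (n := n) hp0
  set m := IsLocalRing.maximalIdeal (MvPowerSeries (Fin n) V)
  obtain ⟨k, hk⟩ := exists_maximalIdeal_pow_le_annihilator hp (M := LinearMap.range g)
    (by rw [← Submodule.map_top]; exact (IsNoetherian.noetherian ⊤).map g)
  -- Artin–Rees: `m^(c+k) ∩ I` lies in `m^k I`, which `g` kills.
  obtain ⟨c, hc⟩ := Ideal.exists_pow_inf_eq_pow_smul m I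
  have hker : ∀ x (hx : x ∈ I), x ∈ m ^ (c + k) → g ⟨x, hx⟩ = 0 := by
    intro x hx hxm
    have h1 : x ∈ m ^ k • (I : Submodule (MvPowerSeries (Fin n) V) _) := by
      have h2 := hc (c + k) (Nat.le_add_right _ _)
      rw [Nat.add_sub_cancel_left] at h2
      have h3 : x ∈ m ^ (c + k) • ⊤ ⊓ I := ⟨by simpa using hxm, hx⟩
      rw [h2] at h3
      exact Submodule.smul_mono le_rfl inf_le_right h3
    suffices h3 : ∃ hx : x ∈ I, g ⟨x, hx⟩ = 0 from h3.2
    clear hx hxm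
    induction h1 using Submodule.smul_induction_on' with
    | smul r hr y hy =>
      refine ⟨I.smul_mem r hy, ?_⟩
      have h4 : (⟨r • y, I.smul_mem r hy⟩ : I) = r • ⟨y, hy⟩ := rfl
      rw [h4, map_smul]
      exact Submodule.mem_annihilator.1 (hk hr) _ (LinearMap.mem_range_self g _)
    | add y _ z _ hy hz =>
      obtain ⟨hy, hgy⟩ := hy
      obtain ⟨hz, hgz⟩ := hz
      refine ⟨I.add_mem hy hz, ?_⟩
      have h4 : (⟨y + z, I.add_mem hy hz⟩ : I) = ⟨y, hy⟩ + ⟨z, hz⟩ := rfl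
      rw [h4, map_add, hgy, hgz, add_zero]
  let ι : I →ₗ[V] MvPowerSeries (Fin n) V ⧸ (m ^ (c + k)) :=
    ((m ^ (c + k)).mkQ.comp I.subtype).restrictScalars V
  let ψ : I →ₗ[V] FractionQuotient V := res.comp (g.restrictScalars V)
  have hle : LinearMap.ker ι ≤ LinearMap.ker ψ := by
    rintro ⟨x, hx⟩ h
    have h1 : x ∈ m ^ (c + k) := (Submodule.Quotient.mk_eq_zero _).1 h
    change res (g ⟨x, hx⟩) = 0
    rw [hker x hx h1, map_zero]
  -- `res ∘ g` descends to the image of `I` in `S / m^(c+k)` and extends from there by injectivity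
  -- of `Frac V / V`.
  obtain ⟨h, hh⟩ := (FractionQuotient.baer V).extension_property
    ((LinearMap.ker ι).liftQ ι le_rfl)
    (LinearMap.ker_eq_bot.1 (Submodule.ker_liftQ_eq_bot _ _ _ le_rfl))
    ((LinearMap.ker ι).liftQ ψ hle)
  let φ : MvPowerSeries (Fin n) V →ₗ[V] FractionQuotient V :=
    h.comp ((m ^ (c + k)).mkQ.restrictScalars V)
  have hφI : ∀ x (hx : x ∈ I), φ x = res (g ⟨x, hx⟩) := fun x hx =>
    LinearMap.congr_fun hh (Submodule.Quotient.mk ⟨x, hx⟩)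
  obtain ⟨e, he⟩ := exists_residue_representative hp0 hres (K := c + k) φ (fun i t => by
    have h1 : paramSystem V p n i ^ (c + k + 1) * t ∈ m ^ (c + k) :=
      Ideal.mul_mem_right _ _ (Ideal.pow_le_pow_right (Nat.le_succ _)
        (Ideal.pow_mem_pow (paramSystem_mem_maximalIdeal hp i) _))
    change h ((m ^ (c + k)).mkQ _) = 0
    rw [Submodule.mkQ_apply, (Submodule.Quotient.mk_eq_zero _).2 h1, map_zero])
  refine ⟨LinearMap.toSpanSingleton _ _ e, fun x hx => ?_⟩
  rw [LinearMap.toSpanSingleton_apply, ← sub_eq_zero]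
  -- Agreement of residues on `I` becomes equality in `E` by testing against every multiple `t * x`,
  -- which again lies in `I`.
  refine eq_zero_of_residue hp0 hres fun t => ?_
  have h1 := hφI (t * x) (I.mul_mem_left t hx)
  have h2 : (⟨t * x, I.mul_mem_left t hx⟩ : I) = t • ⟨x, hx⟩ := rfl
  rw [he, h2, g.map_smul] at h1
  rw [smul_sub, map_sub, smul_smul, h1, sub_self]

theorem isInjectiveHull [IsLocalRing V] [IsPrincipalIdealRing V] (hp0 : (p : V) ≠ 0)
    (hp : IsLocalRing.maximalIdeal V = Ideal.span {(p : V)}) :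
    IsInjectiveHull (MvPowerSeries (Fin n) V)
      (IsLocalRing.ResidueField (MvPowerSeries (Fin n) V)) (HullModule V p n) :=
  ⟨(baer hp0 hp).injective, exists_residueField_embedding hp0 hp⟩

end Pairing

end HullModule

/-! ### Taylor homomorphisms and differential operators -/

section TaylorOperators

variable {V S T : Type*} [CommRing V] [CommRing S] [CommRing T] [Algebra V S] [Algebra V T]
  [Algebra S T] [IsScalarTower V S T]

/-- The operator taking `x` to the `t`-th coefficient of `τ x`. -/
noncomputable def taylorCoeff (τ : T →ₐ[V] PowerSeries T) (t : ℕ) : Module.End V T where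
  toFun x := PowerSeries.coeff t (τ x)
  map_add' x y := by rw [map_add, map_add]
  map_smul' v x := by rw [map_smul]; rfl

theorem taylorCoeff_apply (τ : T →ₐ[V] PowerSeries T) (t : ℕ) (x : T) :
    taylorCoeff τ t x = PowerSeries.coeff t (τ x) := rfl

theorem OrderLT.sum {ι : Type*} {k : ℕ} {A : Finset ι} {φ : ι → Module.End V T}
    (h : ∀ i ∈ A, OrderLT S k (φ i)) : OrderLT S k (∑ i ∈ A, φ i) :=
  Finset.sum_induction _ _ (fun _ _ => OrderLT.add) (OrderLT.zero k) h

theorem orderLT_one_mulLeft (x : T) : OrderLT S 1 (LinearMap.mulLeft V x) := by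
  intro s
  change actionComm _ s = 0
  ext y
  simp

/-- The coefficients of a Taylor homomorphism are differential operators. -/
theorem orderLT_taylorCoeff {τ : T →ₐ[V] PowerSeries T}
    (hτ : ∀ x, PowerSeries.constantCoeff (τ x) = x) (t : ℕ) :
    OrderLT S (2 * t + 1) (taylorCoeff τ t) := by
  induction t using Nat.strong_induction_on with
  | _ t ih =>
  intro s
  -- In the product rule for `τ (s x)` the `(0, t)` term is `s • taylorCoeff τ t x` and cancels. The
  -- others involve strictly lower coefficients; each multiplication costs one in the order bound,
  -- whence `2 * t + 1`, which is not sharp.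
  have hc : actionComm (taylorCoeff τ t) s = ∑ ab ∈ (Finset.HasAntidiagonal.antidiagonal t).erase (0, t),
      LinearMap.mulLeft V (PowerSeries.coeff ab.1 (τ (algebraMap S T s))) *
        taylorCoeff τ ab.2 := by
    ext x
    rw [actionComm_apply, Algebra.smul_def, taylorCoeff_apply, map_mul, PowerSeries.coeff_mul,
      ← Finset.add_sum_erase _ _ (Finset.HasAntidiagonal.mem_antidiagonal.2 (show (0, t).1 + (0, t).2 = t from zero_add t)), Algebra.smul_def,
      PowerSeries.coeff_zero_eq_constantCoeff_apply, hτ, taylorCoeff_apply, add_sub_cancel_left,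
      LinearMap.sum_apply]
    rfl
  rw [hc]
  refine OrderLT.sum fun ab hab => ?_
  obtain ⟨hne, hmem⟩ := Finset.mem_erase.1 hab
  rw [Finset.HasAntidiagonal.mem_antidiagonal] at hmem
  have hlt : ab.2 < t := by
    refine lt_of_le_of_ne (by omega) fun h => hne ?_
    ext <;> simp <;> omega
  exact ((orderLT_one_mulLeft _).mul (ih _ hlt)).mono (by omega)

theorem taylorCoeff_mem_diffOpRing {σ : S →ₐ[V] PowerSeries S}
    (hσ : ∀ x, PowerSeries.constantCoeff (σ x) = x) (t : ℕ) :
    taylorCoeff σ t ∈ DiffOpRing V S :=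
  ⟨2 * t, (isDiffOp_iff_orderLT _ _).2 (orderLT_taylorCoeff (S := S) (T := S) hσ t)⟩

end TaylorOperators

/-! ### Translations and divided partial derivatives -/

namespace HullModule

section Translation

variable {V : Type*} [CommRing V] {n : ℕ}

/-- No continuity is assumed: the coefficient at `b` ignores multiples of high powers of the
variables, and `ψ` preserves such multiples. What remains is a finite combination of monomials. -/
theorem _root_.MvPowerSeries.algHom_eq_id
    {ψ : MvPowerSeries (Fin n) V →ₐ[V] MvPowerSeries (Fin n) V}
    (h : ∀ j, ψ (MvPowerSeries.X j) = MvPowerSeries.X j) (s : MvPowerSeries (Fin n) V) :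
    ψ s = s := by
  ext b
  have key : (MvPowerSeries.coeff b).comp ψ.toLinearMap = MvPowerSeries.coeff b := by
    have hb : ∀ i, b i ≤ ∑ j, b j := fun i =>
      Finset.single_le_sum (f := b) (fun _ _ => Nat.zero_le _) (Finset.mem_univ i)
    have hX : ∀ (i : Fin n) (g : MvPowerSeries (Fin n) V),
        MvPowerSeries.coeff b (MvPowerSeries.X i ^ ((∑ j, b j) + 1) * g) = 0 := fun i g =>
      MvPowerSeries.X_pow_dvd_iff.1 (Dvd.intro _ rfl) _ (Nat.lt_succ_of_le (hb i))
    refine MvPowerSeries.linearMap_ext_of_monomial (fun i g => ?_) hX fun c _ => ?_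
    · change MvPowerSeries.coeff b (ψ _) = 0
      rw [map_mul, map_pow, h, hX]
    · change MvPowerSeries.coeff b (ψ _) = _
      rw [MvPowerSeries.monomial_one_eq, map_finsuppProd]
      simp_rw [map_pow, h]
  exact LinearMap.congr_fun key s

variable (V) in
theorem hasSubst_translation (i : Fin n) : MvPowerSeries.HasSubst fun j : Fin n =>
    (MvPowerSeries.X (some j) + if j = i then MvPowerSeries.X none else 0 :
      MvPowerSeries (Option (Fin n)) V) :=
  MvPowerSeries.hasSubst_of_constantCoeff_zero fun j => by split_ifs <;> simp

variable (V) in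
/-- The Taylor homomorphism `s ↦ s(x_1, …, x_i + u, …, x_n)`. -/
noncomputable def translation (i : Fin n) :
    MvPowerSeries (Fin n) V →ₐ[V] PowerSeries (MvPowerSeries (Fin n) V) :=
  (MvPowerSeries.optionEquivLeft (Fin n) V).toAlgHom.comp
    (MvPowerSeries.substAlgHom (hasSubst_translation V i))

theorem translation_X (i j : Fin n) : translation V i (MvPowerSeries.X j) =
    PowerSeries.C (MvPowerSeries.X j) + if j = i then PowerSeries.X else 0 := by
  change MvPowerSeries.optionEquivLeft (Fin n) V
    (MvPowerSeries.substAlgHom (hasSubst_translation V i) _) = _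
  rw [MvPowerSeries.substAlgHom_X, map_add, MvPowerSeries.optionEquivLeft_X_some]
  split_ifs <;> simp

theorem constantCoeff_translation (i : Fin n) (s : MvPowerSeries (Fin n) V) :
    PowerSeries.constantCoeff (translation V i s) = s := by
  let c : PowerSeries (MvPowerSeries (Fin n) V) →ₐ[V] MvPowerSeries (Fin n) V :=
    { PowerSeries.constantCoeff (R := MvPowerSeries (Fin n) V) with
      commutes' := fun v => by
        change PowerSeries.constantCoeff (algebraMap V _ v) = _
        rw [PowerSeries.algebraMap_apply, PowerSeries.constantCoeff_C] }
  have hc : ∀ f, c f = PowerSeries.constantCoeff f := fun _ => rfl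
  have key : ∀ s, c.comp (translation V i) s = s := by
    refine MvPowerSeries.algHom_eq_id fun j => ?_
    rw [AlgHom.comp_apply, hc, translation_X]
    split_ifs <;> simp
  rw [← hc, ← AlgHom.comp_apply, key]

variable (V) in
/-- The divided power `(1 / t!) (∂ / ∂ x_i) ^ t`, as a differential operator of `V[[x]]`. -/
noncomputable def dividedPartial (i : Fin n) (t : ℕ) : DiffOpRing V (MvPowerSeries (Fin n) V) :=
  ⟨taylorCoeff (translation V i) t,
    taylorCoeff_mem_diffOpRing (σ := translation V i) (constantCoeff_translation i) t⟩

variable (p : ℕ)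

/-- The homomorphism `translation`, with values in the power series over the localization. -/
noncomputable def translationToLoc (i : Fin n) :
    MvPowerSeries (Fin n) V →ₐ[V] PowerSeries (ParamLoc V p n) :=
  (PowerSeries.mapAlgHom (IsScalarTower.toAlgHom V (MvPowerSeries (Fin n) V)
    (ParamLoc V p n))).comp (translation V i)

theorem coeff_translationToLoc (i : Fin n) (t : ℕ) (s : MvPowerSeries (Fin n) V) :
    PowerSeries.coeff t (translationToLoc p i s) =
      algebraMap _ (ParamLoc V p n) (PowerSeries.coeff t (translation V i s)) := by
  exact PowerSeries.coeff_map (algebraMap _ (ParamLoc V p n)) t (translation V i s)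

theorem isUnit_translationToLoc (i : Fin n)
    (w : Submonoid.powers (∏ j, paramSystem V p n j)) :
    IsUnit (translationToLoc p i (w : MvPowerSeries (Fin n) V)) := by
  rw [PowerSeries.isUnit_iff_constantCoeff, ← PowerSeries.coeff_zero_eq_constantCoeff_apply,
    coeff_translationToLoc, PowerSeries.coeff_zero_eq_constantCoeff_apply,
    constantCoeff_translation]
  exact IsLocalization.map_units _ w

/-- The Taylor homomorphism of the localization `S_{p x_1 ⋯ x_n}` in the variable `x_i`. -/
noncomputable def locTranslation (i : Fin n) :
    ParamLoc V p n →ₐ[V] PowerSeries (ParamLoc V p n) :=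
  IsLocalization.liftAlgHom (M := Submonoid.powers (∏ j, paramSystem V p n j))
    (f := translationToLoc p i) (isUnit_translationToLoc p i)

theorem locTranslation_algebraMap (i : Fin n) (s : MvPowerSeries (Fin n) V) :
    locTranslation p i (algebraMap _ (ParamLoc V p n) s) = translationToLoc p i s := by
  simp [locTranslation, IsLocalization.liftAlgHom_apply]

theorem constantCoeff_locTranslation (i : Fin n) (x : ParamLoc V p n) :
    PowerSeries.constantCoeff (locTranslation p i x) = x := by
  have key : (PowerSeries.constantCoeff (R := ParamLoc V p n)).comp
      (locTranslation p i).toRingHom = RingHom.id _ := by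
    refine IsLocalization.ringHom_ext (Submonoid.powers (∏ j, paramSystem V p n j)) ?_
    ext1 s
    change PowerSeries.constantCoeff (locTranslation p i (algebraMap _ _ s)) = algebraMap _ _ s
    rw [locTranslation_algebraMap, ← PowerSeries.coeff_zero_eq_constantCoeff_apply,
      coeff_translationToLoc, PowerSeries.coeff_zero_eq_constantCoeff_apply,
      constantCoeff_translation]
  exact RingHom.congr_fun key x

/-- Taylor coefficients on the localization are differential operators extending those on `S`, so
uniqueness of the extension identifies the two. -/
theorem actLoc_dividedPartial (i : Fin n) (t : ℕ) (x : ParamLoc V p n) :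
    TopLocalCohomology.actLoc V (paramSystem V p n) (dividedPartial V i t) x =
      PowerSeries.coeff t (locTranslation p i x) := by
  refine LinearMap.congr_fun (DiffOpRing.extend_unique
    (Submonoid.powers (∏ j, paramSystem V p n j)) (dividedPartial V i t)
    (Q := taylorCoeff (locTranslation p i) t)
    (orderLT_taylorCoeff (τ := locTranslation p i) (constantCoeff_locTranslation p i) t) fun s => ?_) x
  rw [taylorCoeff_apply, locTranslation_algebraMap, coeff_translationToLoc]
  rfl

variable (V)

/-- The inverse of the parameter `y_i` in the localization. -/
noncomputable def paramInv (i : Option (Fin n)) : ParamLoc V p n :=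
  algebraMap _ (ParamLoc V p n) (∏ j ∈ Finset.univ.erase i, paramSystem V p n j) * invProd V p n

variable {V p}

theorem algebraMap_mul_paramInv (i : Option (Fin n)) :
    algebraMap _ (ParamLoc V p n) (paramSystem V p n i) * paramInv V p i = 1 := by
  rw [paramInv, ← mul_assoc, ← map_mul, Finset.mul_prod_erase _ _ (Finset.mem_univ i)]
  exact algebraMap_paramProd_mul_invProd

theorem invProd_eq_prod :
    invProd V p n = paramInv V p none * ∏ i : Fin n, paramInv V p (some i) := by
  rw [← Fintype.prod_option fun i => paramInv V p i]
  refine left_inv_eq_right_inv (a := algebraMap _ (ParamLoc V p n) (paramProd V p n)) ?_ ?_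
  · rw [mul_comm, algebraMap_paramProd_mul_invProd]
  · rw [paramProd, map_prod, ← Finset.prod_mul_distrib]
    exact Finset.prod_eq_one fun i _ => algebraMap_mul_paramInv i

theorem locTranslation_paramInv {i : Fin n} {j : Option (Fin n)} (h : j ≠ some i) :
    locTranslation p i (paramInv V p j) = PowerSeries.C (paramInv V p j) := by
  have h1 : locTranslation p i (algebraMap _ (ParamLoc V p n) (paramSystem V p n j)) =
      PowerSeries.C (algebraMap _ (ParamLoc V p n) (paramSystem V p n j)) := by
    cases j with
    | none =>
      change locTranslation p i (algebraMap _ _ (p : MvPowerSeries (Fin n) V)) =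
        PowerSeries.C (algebraMap _ _ (p : MvPowerSeries (Fin n) V))
      simp
    | some j =>
      rw [locTranslation_algebraMap]
      change PowerSeries.map (algebraMap _ (ParamLoc V p n)) (translation V i (MvPowerSeries.X j)) = _
      rw [translation_X, if_neg fun hji => h (congrArg some hji), add_zero, PowerSeries.map_C]
      rfl
  refine left_inv_eq_right_inv
    (a := PowerSeries.C (algebraMap _ (ParamLoc V p n) (paramSystem V p n j))) ?_ ?_
  · rw [← h1, ← map_mul, mul_comm, algebraMap_mul_paramInv, map_one]
  · rw [← map_mul, algebraMap_mul_paramInv, map_one]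

/-- This is the geometric series of `1 / (x_i + u)` in `u`, obtained recursively from `(x_i + u) τ(1
/ x_i) = 1`. -/
theorem coeff_locTranslation_paramInv_self (i : Fin n) (t : ℕ) :
    PowerSeries.coeff t (locTranslation p i (paramInv V p (some i))) =
      (-1) ^ t * paramInv V p (some i) ^ (t + 1) := by
  set x := algebraMap _ (ParamLoc V p n) (paramSystem V p n (some i)) with hx
  set z := paramInv V p (some i) with hz
  have hxz : x * z = 1 := algebraMap_mul_paramInv (some i)
  have h1 : locTranslation p i x = PowerSeries.C x + PowerSeries.X := by
    rw [hx, locTranslation_algebraMap]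
    change PowerSeries.map (algebraMap _ (ParamLoc V p n)) (translation V i (MvPowerSeries.X i)) = _
    rw [translation_X, if_pos rfl, map_add, PowerSeries.map_C, PowerSeries.map_X]
    rfl
  have h2 : (PowerSeries.C x + PowerSeries.X) * locTranslation p i z = 1 := by
    rw [← h1, ← map_mul, hxz, map_one]
  induction t with
  | zero =>
    rw [PowerSeries.coeff_zero_eq_constantCoeff_apply, constantCoeff_locTranslation]
    ring
  | succ t ih =>
    have h3 := congrArg (PowerSeries.coeff (t + 1)) h2
    rw [add_mul, map_add, PowerSeries.coeff_C_mul, PowerSeries.coeff_succ_X_mul, ih,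
      PowerSeries.coeff_one, if_neg (Nat.succ_ne_zero t)] at h3
    linear_combination z * h3 -
      PowerSeries.coeff (t + 1) (locTranslation p i z) * hxz

theorem dividedPartial_smul_mk {i : Fin n} {z : ParamLoc V p n}
    (hz : locTranslation p i z = PowerSeries.C z) (t : ℕ) :
    dividedPartial V i t • TopLocalCohomology.mk (paramSystem V p n)
        (paramInv V p (some i) * z) =
      TopLocalCohomology.mk (paramSystem V p n)
        ((-1) ^ t * (paramInv V p (some i) ^ (t + 1) * z)) := by
  rw [TopLocalCohomology.smul_mk, actLoc_dividedPartial, map_mul, hz, PowerSeries.coeff_mul_C,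
    coeff_locTranslation_paramInv_self, mul_assoc]

end Translation

end HullModule

/-! ### Submodules over the differential operators -/

namespace HullModule

section Submodules

variable {V : Type*} [CommRing V] {p n : ℕ}

theorem smul_mem_of_diffOp
    (N : Submodule (DiffOpRing V (MvPowerSeries (Fin n) V)) (HullModule V p n))
    (s : MvPowerSeries (Fin n) V) {e : HullModule V p n} (he : e ∈ N) : s • e ∈ N := by
  rw [← TopLocalCohomology.mulOp_smul V]
  exact N.smul_mem _ he

/-- The factors other than `1 / x_i` are constant in the direction `x_i`, so the `t`-th divided
derivative raises the exponent of `1 / x_i` alone, up to a sign. -/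
theorem mk_mem_of_update
    {N : Submodule (DiffOpRing V (MvPowerSeries (Fin n) V)) (HullModule V p n)}
    {i : Fin n} {l : ℕ} {m : Fin n → ℕ} (hm : m i = 1)
    (h : TopLocalCohomology.mk (paramSystem V p n)
      (paramInv V p none ^ l * ∏ j, paramInv V p (some j) ^ m j) ∈ N) (t : ℕ) :
    TopLocalCohomology.mk (paramSystem V p n) (paramInv V p none ^ l *
      ∏ j, paramInv V p (some j) ^ Function.update m i (t + 1) j) ∈ N := by
  classical
  set z := paramInv V p none ^ l * ∏ j ∈ Finset.univ.erase i, paramInv V p (some j) ^ m j with hz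
  have hτ : locTranslation p i z = PowerSeries.C z := by
    rw [hz]
    simp only [map_mul, map_pow, map_prod]
    rw [locTranslation_paramInv (by simp)]
    congr 1
    refine Finset.prod_congr rfl fun j hj => ?_
    rw [locTranslation_paramInv]
    simpa using Finset.ne_of_mem_erase hj
  have h1 : paramInv V p none ^ l * ∏ j, paramInv V p (some j) ^ m j =
      paramInv V p (some i) * z := by
    rw [← Finset.mul_prod_erase _ _ (Finset.mem_univ i), hm]
    ring
  have h2 : paramInv V p none ^ l * ∏ j, paramInv V p (some j) ^ Function.update m i (t + 1) j =
      paramInv V p (some i) ^ (t + 1) * z := by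
    rw [← Finset.mul_prod_erase _ _ (Finset.mem_univ i), Function.update_self, hz]
    rw [Finset.prod_congr rfl (g := fun j => paramInv V p (some j) ^ m j) fun j hj => by
      rw [Function.update_of_ne (Finset.ne_of_mem_erase hj)]]
    ring
  rw [h1] at h
  have h3 := N.smul_mem (dividedPartial V i t) h
  rw [dividedPartial_smul_mk hτ] at h3
  have h4 := smul_mem_of_diffOp N ((-1) ^ t) h3
  rw [← map_smul, Algebra.smul_def, map_pow, map_neg, map_one, ← mul_assoc, ← mul_pow] at h4
  rw [h2]
  simpa using h4

theorem mk_mem_of_forall_one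
    {N : Submodule (DiffOpRing V (MvPowerSeries (Fin n) V)) (HullModule V p n)} {l : ℕ}
    (h : TopLocalCohomology.mk (paramSystem V p n)
      (paramInv V p none ^ l * ∏ j : Fin n, paramInv V p (some j)) ∈ N) (K : ℕ) :
    TopLocalCohomology.mk (paramSystem V p n) (paramInv V p none ^ l *
      ∏ j : Fin n, paramInv V p (some j) ^ (K + 1)) ∈ N := by
  classical
  -- The denominator exponents are raised one variable at a time; `A` is the set of variables
  -- already treated.
  have key : ∀ A : Finset (Fin n), TopLocalCohomology.mk (paramSystem V p n)
      (paramInv V p none ^ l *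
        ∏ j : Fin n, paramInv V p (some j) ^ (if j ∈ A then K + 1 else 1)) ∈ N := by
    intro A
    induction A using Finset.induction_on with
    | empty => simpa using h
    | insert i A hi ih =>
      have h1 := mk_mem_of_update (i := i) (by simp [hi]) ih K
      convert h1 using 6 with j
      by_cases hij : j = i
      · subst hij; simp
      · simp [hij]
  simpa using key Finset.univ

theorem monomial_smul_mul_prod_paramInv (l : ℕ) (x : ParamLoc V p n) :
    (MvPowerSeries.monomial (constExp n l) 1 : MvPowerSeries (Fin n) V) •
      (x * ∏ j : Fin n, paramInv V p (some j) ^ (l + 1)) =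
      x * ∏ j : Fin n, paramInv V p (some j) := by
  rw [← sum_single_eq_constExp, ← prod_X_pow, Algebra.smul_def, map_prod, mul_left_comm,
    ← Finset.prod_mul_distrib]
  congr 1
  refine Finset.prod_congr rfl fun j _ => ?_
  have h := algebraMap_mul_paramInv (V := V) (p := p) (some j)
  rw [pow_succ, ← mul_assoc, map_pow, ← mul_pow]
  change (algebraMap _ _ (paramSystem V p n (some j)) * _) ^ l * _ = _
  rw [h, one_pow, one_mul]

theorem socleGen_eq_mk (l : ℕ) : socleGen V p n l = TopLocalCohomology.mk (paramSystem V p n)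
    (paramInv V p none ^ (l + 1) * ∏ j : Fin n, paramInv V p (some j)) := by
  rw [socleGen, invGen, ← map_smul, invProd_eq_prod, mul_pow,
    ← Finset.prod_pow, monomial_smul_mul_prod_paramInv]

theorem C_pow_smul_invGen_eq_mk (k l : ℕ) :
    (MvPowerSeries.C ((p : V) ^ k) : MvPowerSeries (Fin n) V) • invGen V p n (k + l) =
      TopLocalCohomology.mk (paramSystem V p n) (paramInv V p none ^ (l + 1) *
        ∏ j : Fin n, paramInv V p (some j) ^ (k + l + 1)) := by
  rw [invGen, ← map_smul, invProd_eq_prod, mul_pow, ← Finset.prod_pow,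
    Algebra.smul_def, ← mul_assoc, add_assoc k l 1, pow_add _ k, ← mul_assoc, map_pow, map_pow,
    ← natCast_eq_C, ← mul_pow]
  have h := algebraMap_mul_paramInv (V := V) (p := p) (n := n) none
  change algebraMap _ _ (p : MvPowerSeries (Fin n) V) * _ = 1 at h
  rw [h, one_pow, one_mul]

variable [IsDomain V]

/-- Differentiation produces `1 / (p^(l+1) x^(K+1))` for every `K`, and every element killed by
`p^(l+1)` is an `S`-multiple of one of these. -/
theorem mem_of_socleGen_mem (hp0 : (p : V) ≠ 0)
    {N : Submodule (DiffOpRing V (MvPowerSeries (Fin n) V)) (HullModule V p n)} {l : ℕ}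
    (h : socleGen V p n l ∈ N) {e : HullModule V p n}
    (he : (MvPowerSeries.C ((p : V) ^ (l + 1)) : MvPowerSeries (Fin n) V) • e = 0) : e ∈ N := by
  obtain ⟨K, t, hlK, rfl⟩ := exists_eq_smul_C_smul_invGen hp0 he
  obtain ⟨k, rfl⟩ := Nat.exists_eq_add_of_le' hlK
  rw [Nat.add_sub_cancel, C_pow_smul_invGen_eq_mk]
  rw [socleGen_eq_mk] at h
  exact smul_mem_of_diffOp N t (mk_mem_of_forall_one h _)

theorem eq_top_of_forall_socleGen_mem (hp0 : (p : V) ≠ 0)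
    {N : Submodule (DiffOpRing V (MvPowerSeries (Fin n) V)) (HullModule V p n)}
    (h : ∀ l, socleGen V p n l ∈ N) : N = ⊤ := by
  refine eq_top_iff.2 fun e _ => ?_
  obtain ⟨l, hl⟩ := exists_C_pow_smul_eq_zero e
  exact mem_of_socleGen_mem hp0 (h l) hl

variable [IsLocalRing V]

/-- Some `s` carries `p^l e` to `1 / (p x)`, so `s e` and `1 / (p^(l+1) x)` differ by an element
killed by `p^l`. By induction that difference already lies in `N`. -/
theorem socleGen_mem_of_smul_ne_zero (hp0 : (p : V) ≠ 0)
    (hp : IsLocalRing.maximalIdeal V = Ideal.span {(p : V)})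
    {N : Submodule (DiffOpRing V (MvPowerSeries (Fin n) V)) (HullModule V p n)} {l : ℕ}
    {e : HullModule V p n} (he : e ∈ N)
    (hl : (MvPowerSeries.C ((p : V) ^ l) : MvPowerSeries (Fin n) V) • e ≠ 0) :
    socleGen V p n l ∈ N := by
  induction l with
  | zero =>
    obtain ⟨s, hs⟩ := exists_smul_eq_socleGen_zero hp0 hp hl
    rw [pow_zero, map_one, one_smul] at hs
    exact hs ▸ smul_mem_of_diffOp N s he
  | succ l ih =>
    obtain ⟨s, hs⟩ := exists_smul_eq_socleGen_zero hp0 hp hl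
    have h1 : socleGen V p n l ∈ N := ih fun h0 => hl (by
      rw [pow_succ', map_mul, mul_smul, h0, smul_zero])
    have h2 : s • e - socleGen V p n (l + 1) ∈ N := mem_of_socleGen_mem hp0 h1 (by
      rw [smul_sub, smul_comm, hs, sub_eq_zero]
      exact (C_pow_smul_socleGen (l + 1) 0).symm)
    have h3 := N.add_mem (smul_mem_of_diffOp N s he) (smul_mem_of_diffOp N (-1) h2)
    rwa [neg_smul, one_smul, neg_sub, add_sub_cancel] at h3

theorem exists_eq_annihilator (hp0 : (p : V) ≠ 0)
    (hp : IsLocalRing.maximalIdeal V = Ideal.span {(p : V)})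
    {N : Submodule (DiffOpRing V (MvPowerSeries (Fin n) V)) (HullModule V p n)} (hN : N ≠ ⊤) :
    ∃ l : ℕ, ∀ e, e ∈ N ↔
      (MvPowerSeries.C ((p : V) ^ l) : MvPowerSeries (Fin n) V) • e = 0 := by
  classical
  have hex : ∃ l : ℕ, ∀ e ∈ N,
      (MvPowerSeries.C ((p : V) ^ l) : MvPowerSeries (Fin n) V) • e = 0 := by
    by_contra! hcon
    refine hN (eq_top_of_forall_socleGen_mem hp0 fun l => ?_)
    obtain ⟨e, he, hle⟩ := hcon l
    exact socleGen_mem_of_smul_ne_zero hp0 hp he hle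
  -- For the least exponent `l + 1` killing `N`, minimality supplies an element of `N` not killed by
  -- `p^l`; exponent zero means `N = 0`.
  refine ⟨Nat.find hex, fun e => ⟨Nat.find_spec hex e, fun he => ?_⟩⟩
  cases hl : Nat.find hex with
  | zero =>
    rw [hl, pow_zero, map_one, one_smul] at he
    exact he ▸ N.zero_mem
  | succ l =>
    rw [hl] at he
    have hmin := Nat.find_min hex (m := l) (by omega)
    push Not at hmin
    obtain ⟨e', he', hle'⟩ := hmin
    exact mem_of_socleGen_mem hp0 (socleGen_mem_of_smul_ne_zero hp0 hp he' hle') he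

end Submodules

/-! ### Endomorphisms over the differential operators -/

section Endomorphisms

variable {V : Type*} [CommRing V] {p n : ℕ}

theorem forall_pow_dvd_imp_eq_zero [IsLocalRing V] [IsHausdorff (IsLocalRing.maximalIdeal V) V]
    (hp : IsLocalRing.maximalIdeal V = Ideal.span {(p : V)}) {a : V}
    (h : ∀ l, (p : V) ^ l ∣ a) : a = 0 := by
  refine IsHausdorff.haus ‹_› a fun l => ?_
  rw [SModEq.zero, hp, Ideal.span_singleton_pow, smul_eq_mul, Ideal.mul_top,
    Ideal.mem_span_singleton]
  exact h l

theorem exists_forall_pow_dvd_sub [IsLocalRing V]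
    [IsPrecomplete (IsLocalRing.maximalIdeal V) V]
    (hp : IsLocalRing.maximalIdeal V = Ideal.span {(p : V)}) {a : ℕ → V}
    (h : ∀ k l, (p : V) ^ l ∣ a l - a (k + l)) : ∃ b, ∀ l, (p : V) ^ l ∣ a l - b := by
  have hmod : ∀ (l : ℕ) (x y : V), x ≡ y [SMOD (IsLocalRing.maximalIdeal V ^ l • ⊤ :
      Submodule V V)] ↔ (p : V) ^ l ∣ x - y := fun l x y => by
    rw [SModEq.sub_mem, hp, Ideal.span_singleton_pow, smul_eq_mul, Ideal.mul_top,
      Ideal.mem_span_singleton]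
  obtain ⟨b, hb⟩ := IsPrecomplete.prec ‹_› (f := a) (fun {l m} hlm => by
    obtain ⟨k, rfl⟩ := Nat.exists_eq_add_of_le' hlm
    exact (hmod _ _ _).2 (h k l))
  exact ⟨b, fun l => (hmod _ _ _).1 (hb l)⟩

theorem algebraMap_end_bijective [IsDomain V] [IsLocalRing V] [IsAdicComplete (IsLocalRing.maximalIdeal V) V]
    (hp0 : (p : V) ≠ 0) (hp : IsLocalRing.maximalIdeal V = Ideal.span {(p : V)}) :
    Function.Bijective (algebraMap V
      (Module.End (DiffOpRing V (MvPowerSeries (Fin n) V)) (HullModule V p n))) := by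
  have happ : ∀ (v : V) (e : HullModule V p n), algebraMap V
      (Module.End (DiffOpRing V (MvPowerSeries (Fin n) V)) (HullModule V p n)) v e =
        (MvPowerSeries.C v : MvPowerSeries (Fin n) V) • e := fun _ _ => rfl
  constructor
  · rw [injective_iff_map_eq_zero]
    intro v hv
    refine forall_pow_dvd_imp_eq_zero hp fun l => ?_
    have h1 := LinearMap.congr_fun hv (socleGen V p n l)
    rw [happ, LinearMap.zero_apply, C_smul_socleGen_eq_zero_iff hp0] at h1
    exact (pow_dvd_pow _ (Nat.le_succ l)).trans h1
  · intro φ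
    have hφ : ∀ (s : MvPowerSeries (Fin n) V) e, φ (s • e) = s • φ e := fun s e => by
      rw [← TopLocalCohomology.mulOp_smul V, map_smul, TopLocalCohomology.mulOp_smul]
    have ha : ∀ l, ∃ a : V, φ (socleGen V p n l) =
        (MvPowerSeries.C a : MvPowerSeries (Fin n) V) • socleGen V p n l := fun l =>
      exists_eq_C_smul_socleGen hp0 (fun i => by rw [← hφ, X_smul_socleGen, map_zero])
        (by rw [← hφ, (C_smul_socleGen_eq_zero_iff hp0).2 dvd_rfl, map_zero])
    choose a ha using ha
    -- Multiplication by `p^k` carries the class of index `k + l` to that of index `l`, so both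
    -- scalars act alike on the latter, whose annihilator in `V` is generated by `p^(l+1)`.
    have hcompat : ∀ k l, (p : V) ^ (l + 1) ∣ a l - a (k + l) := fun k l => by
      rw [← C_smul_socleGen_eq_zero_iff (n := n) hp0, map_sub, sub_smul, ← ha, sub_eq_zero,
        ← C_pow_smul_socleGen k l, hφ, ha, smul_comm]
    obtain ⟨b, hb⟩ := exists_forall_pow_dvd_sub hp (a := a)
      (fun k l => (pow_dvd_pow _ (Nat.le_succ l)).trans (hcompat k l))
    -- The limit only gives `a l ≡ b` modulo `p^l`; passing through `a (l + 1)` gains the missing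
    -- factor of `p`.
    have hb' : ∀ l, (p : V) ^ (l + 1) ∣ a l - b := fun l => by
      have h1 := hcompat 1 l
      have h2 := hb (l + 1)
      rw [add_comm 1 l] at h1
      simpa using dvd_add h1 h2
    refine ⟨b, Eq.symm (sub_eq_zero.1 (LinearMap.ker_eq_top.1
      (eq_top_of_forall_socleGen_mem hp0 fun l => ?_)))⟩
    rw [LinearMap.mem_ker, LinearMap.sub_apply, happ, ha, ← sub_smul, ← map_sub,
      C_smul_socleGen_eq_zero_iff hp0]
    exact hb' l

end Endomorphisms

end HullModule

theorem proposition4p2 (V : Type*) [CommRing V] [IsDomain V] [IsDiscreteValuationRing V]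
    [CharZero V] (p : ℕ) [Fact p.Prime]
    (hp : IsLocalRing.maximalIdeal V = Ideal.span {(p : V)})
    [IsAdicComplete (IsLocalRing.maximalIdeal V) V] (n : ℕ) :
    IsInjectiveHull (MvPowerSeries (Fin n) V)
        (IsLocalRing.ResidueField (MvPowerSeries (Fin n) V)) (HullModule V p n) ∧
      (∀ N : Submodule (DiffOpRing V (MvPowerSeries (Fin n) V)) (HullModule V p n), N ≠ ⊤ →
        ∃ l : ℕ, ∀ e : HullModule V p n,
          e ∈ N ↔ ∀ s ∈ Ideal.span {(p : MvPowerSeries (Fin n) V) ^ l}, s • e = 0) ∧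
      Function.Bijective (algebraMap V
        (Module.End (DiffOpRing V (MvPowerSeries (Fin n) V)) (HullModule V p n))) := by
  have hp0 : (p : V) ≠ 0 := Nat.cast_ne_zero.2 (Fact.out : p.Prime).ne_zero
  refine ⟨HullModule.isInjectiveHull hp0 hp, fun N hN => ?_,
    HullModule.algebraMap_end_bijective hp0 hp⟩
  obtain ⟨l, hl⟩ := HullModule.exists_eq_annihilator hp0 hp hN
  refine ⟨l, fun e => ?_⟩
  rw [hl, map_pow, ← HullModule.natCast_eq_C]
  constructor
  · intro h s hs
    obtain ⟨t, rfl⟩ := Ideal.mem_span_singleton'.1 hs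
    rw [mul_smul, h, smul_zero]
  · exact fun h => h _ (Ideal.mem_span_singleton_self _)
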